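/- Let $K$ be a field and $n_1\ge 2$ an integer. Let $L=L_2(n_1,2)$ be the lattice $\{s,x_1,\dots,x_{n_1},y_1,y_2,t\}$ with $s<x_1<\cdots<x_{n_1}<t$ and $s<y_1<y_2<t$, each $x_i$ being incomparable with each $y_j$. Let $R=K[L]$ be the polynomial ring over $K$, with its standard grading, whose variables are the elements of $L$, let $I_L=(ab-(a\vee b)(a\wedge b) : a,b\in L)\subset R$ be the join-meet ideal of $L$, and let $\mathrm{in}_<(I_L)$ be its initial ideal with respect to the (graded) reverse lexicographic order induced by $s<x_1<\cdots<x_{n_1}<y_1<y_2<t$. Then $R/\mathrm{in}_<(I_L)$ has a minimal graded free resolution $0\leftarrow R/\mathrm{in}_<(I_L)\leftarrow F_0\leftarrow F_1\leftarrow F_2\leftarrow\cdots$ with every $F_i$ finitely generated, and in every such resolution, writing $F_i=\bigoplus_j R(-j)^{B_{i,j}}$, the graded Betti numbers satisfy $$B_{1,2}=2n_1,\qquad B_{1,3}=n_1,\qquad B_{2,3}=2\binom{n_1}{2}+n_1,\qquad B_{2,4}=\binom{n_1-1}{2}+3n_1-2,$$ and $$\sum_{j=0}^{\infty}B_{1,j}=B_{1,2}+B_{1,3}=3n_1,\qquad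 \sum_{j=0}^{\infty}B_{2,j}=B_{2,3}+B_{2,4}=\frac{3n_1^2+3n_1-2}{2}.$$ -/

import Mathlib

/-- The underlying set of the crystal lattice `L_k(n_1, …, n_k)`: a bottom element `s`, a top
element `t`, and `k` disjoint chains `x_{i,1} < ⋯ < x_{i,n_i}` (here `r : Fin (n i)` stands for
the index `r + 1`). -/
inductive CrystalLattice {k : ℕ} (n : Fin k → ℕ) : Type
  | s : CrystalLattice n
  | x (i : Fin k) (r : Fin (n i)) : CrystalLattice n
  | t : CrystalLattice n

namespace CrystalLattice

variable {k : ℕ} {n : Fin k → ℕ}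

/-- The order relation of the crystal lattice: `s` is least, `t` is greatest, each chain is
increasing, and elements of different chains are incomparable. -/
protected def le : CrystalLattice n → CrystalLattice n → Prop
  | s, _ => True
  | _, t => True
  | x i r, x j q => i = j ∧ r.val ≤ q.val
  | _, _ => False

/-- Joins: the join of elements of two different chains is `t`. -/
protected def sup : CrystalLattice n → CrystalLattice n → CrystalLattice n
  | s, b => b
  | a, s => a
  | x i r, x j q => if i = j then (if r.val ≤ q.val then x j q else x i r) else t
  | _, _ => t

/-- Meets: the meet of elements of two different chains is `s`. -/
protected def inf : CrystalLattice n → CrystalLattice n → CrystalLattice n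
  | t, b => b
  | a, t => a
  | x i r, x j q => if i = j then (if r.val ≤ q.val then x i r else x j q) else s
  | _, _ => s

instance : Lattice (CrystalLattice n) where
  le := CrystalLattice.le
  le_refl a := by cases a <;> simp [CrystalLattice.le]
  le_trans a b c := by
    cases a <;> cases b <;> cases c <;> simp [CrystalLattice.le]
    rintro rfl h rfl h'
    exact ⟨rfl, h.trans h'⟩
  le_antisymm a b := by
    cases a <;> cases b <;> simp [CrystalLattice.le]
    rintro rfl h - h'
    exact ⟨rfl, heq_of_eq (Fin.ext (le_antisymm h h'))⟩
  sup := CrystalLattice.sup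
  inf := CrystalLattice.inf
  le_sup_left a b := by
    cases a <;> cases b <;> simp [CrystalLattice.le, CrystalLattice.sup]
    split_ifs <;> simp_all
  le_sup_right a b := by
    cases a <;> cases b <;> simp [CrystalLattice.le, CrystalLattice.sup]
    split_ifs <;> simp_all
    omega
  sup_le a b c := by
    cases a <;> cases b <;> cases c <;> simp [CrystalLattice.le, CrystalLattice.sup] <;>
      (try split_ifs) <;> simp_all
    rintro h1 - h2
    exact absurd (h1.trans h2.symm) (by assumption)
  inf_le_left a b := by
    cases a <;> cases b <;> simp [CrystalLattice.le, CrystalLattice.inf]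
    split_ifs <;> simp_all
    omega
  inf_le_right a b := by
    cases a <;> cases b <;> simp [CrystalLattice.le, CrystalLattice.inf]
    split_ifs <;> simp_all
  le_inf a b c := by
    cases a <;> cases b <;> cases c <;> simp [CrystalLattice.le, CrystalLattice.inf] <;>
      (try split_ifs) <;> simp_all

/-- The strict total order of the variables
`s < x_{1,1} < ⋯ < x_{1,n_1} < x_{2,1} < ⋯ < x_{2,n_2} < ⋯ < x_{k,1} < ⋯ < x_{k,n_k} < t`
(a linear extension of the lattice order). -/
def varLT : CrystalLattice n → CrystalLattice n → Prop
  | s, x _ _ => True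
  | s, t => True
  | x i r, x j q => i < j ∨ (i = j ∧ r.val < q.val)
  | x _ _, t => True
  | _, _ => False

end CrystalLattice

/-- The join-meet ideal `I_L = ({a b - (a ∨ b)(a ∧ b) : a, b ∈ L})` of `K[L]`. -/
noncomputable def joinMeetIdeal (K L : Type*) [Field K] [Lattice L] : Ideal (MvPolynomial L K) :=
  Ideal.span {f | ∃ a b : L, f = MvPolynomial.X a * MvPolynomial.X b -
    MvPolynomial.X (a ⊔ b) * MvPolynomial.X (a ⊓ b)}

/-- `u < v` in the (graded) reverse lexicographic order induced by a strict total order `lt` of the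
variables: either `u` has smaller total degree, or the total degrees agree and at the smallest
variable at which the exponents differ, `u` has the larger exponent. -/
def RevLexLT {σ : Type*} (lt : σ → σ → Prop) (u v : σ →₀ ℕ) : Prop :=
  u.degree < v.degree ∨
    (u.degree = v.degree ∧ ∃ a, v a < u a ∧ ∀ b, lt b a → u b = v b)

/-- `X^u` is the initial monomial of `f` for the reverse lexicographic order induced by `lt`. -/
def IsInitialMonomial {σ K : Type*} [Field K] (lt : σ → σ → Prop) (f : MvPolynomial σ K)
    (u : σ →₀ ℕ) : Prop :=
  u ∈ f.support ∧ ∀ v ∈ f.support, v ≠ u → RevLexLT lt v u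

/-- The initial ideal `in_<(I)`, generated by the initial monomials of the nonzero elements
of `I`, for the reverse lexicographic order induced by `lt`. -/
noncomputable def initialIdeal {σ K : Type*} [Field K] (lt : σ → σ → Prop) (I : Ideal (MvPolynomial σ K)) :
    Ideal (MvPolynomial σ K) :=
  Ideal.span {g | ∃ f ∈ I, ∃ u, IsInitialMonomial lt f u ∧ g = MvPolynomial.monomial u 1}

/-- `p` is homogeneous of degree `e ∈ ℤ` (so `p = 0` if `e < 0`). -/
def IsHomogeneousOfIntDegree {σ K : Type*} [Field K] (p : MvPolynomial σ K) (e : ℤ) : Prop :=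
  ∀ m ∈ p.support, (m.degree : ℤ) = e

/-- A minimal graded free resolution
`0 ← R/J ← F_0 ← F_1 ← F_2 ← ⋯` of `R/J`, where `R` is a polynomial ring with its standard grading.
Here `F_i = ⨁_a R(-deg i a)` has the finite basis `Fin (rank i)`, whose element `a` has degree
`deg i a`. -/
structure MinimalGradedFreeResolution {σ K : Type*} [Field K] (J : Ideal (MvPolynomial σ K)) where
  /-- the rank of `F_i` -/
  rank : ℕ → ℕ
  /-- the degrees of the basis elements of `F_i` -/
  deg : (i : ℕ) → Fin (rank i) → ℤ
  /-- the augmentation `F_0 → R/J` -/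
  aug : (Fin (rank 0) → MvPolynomial σ K) →ₗ[MvPolynomial σ K] (MvPolynomial σ K ⧸ J)
  /-- the differential `F_{i+1} → F_i` -/
  d : (i : ℕ) → (Fin (rank (i + 1)) → MvPolynomial σ K) →ₗ[MvPolynomial σ K]
    (Fin (rank i) → MvPolynomial σ K)
  /-- the augmentation preserves degrees -/
  aug_homogeneous : ∀ a, ∃ p, IsHomogeneousOfIntDegree p (deg 0 a) ∧
    aug (Pi.single a 1) = Ideal.Quotient.mk J p
  /-- the differentials preserve degrees -/
  d_homogeneous : ∀ i b a,
    IsHomogeneousOfIntDegree (d i (Pi.single b 1) a) (deg (i + 1) b - deg i a)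
  aug_surjective : Function.Surjective aug
  exact_zero : Function.Exact (d 0) aug
  exact_succ : ∀ i, Function.Exact (d (i + 1)) (d i)
  /-- minimality: the image of each differential lies in `𝔪 F_i`, `𝔪` the ideal of the variables -/
  minimal : ∀ i v a, d i v a ∈ MvPolynomial.idealOfVars σ K

/-- The graded Betti number `B_{i,j}`: the number of copies of `R(-j)` in `F_i`. -/
def MinimalGradedFreeResolution.betti {σ K : Type*} [Field K] {J : Ideal (MvPolynomial σ K)}
    (S : MinimalGradedFreeResolution J) (i : ℕ) (j : ℤ) : ℕ :=
  (Finset.univ.filter fun b : Fin (S.rank i) => S.deg i b = j).card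

/-- The initial ideal `in_<(I_L)` of the join-meet ideal of the crystal lattice
`L = L_k(n_1, …, n_k)`, for the reverse lexicographic order induced by
`s < x_{1,1} < ⋯ < x_{k,n_k} < t`. -/
noncomputable def crystalInitialIdeal (K : Type*) [Field K] {k : ℕ} (n : Fin k → ℕ) :
    Ideal (MvPolynomial (CrystalLattice n) K) :=
  initialIdeal CrystalLattice.varLT (joinMeetIdeal K (CrystalLattice n))

/-!
The initial ideal `J` of the join-meet ideal is the monomial ideal generated by the `2 n` quadrics
`x_i y_j` and the `n` cubics `s t y_2`, `s t x_k` (`k ≥ 2`)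
(`CrystalLattice.crystalInitialIdeal_eq`). These are the initial monomials of `x_i y_j - s t`,
`s t y_2 - s t y_1`, `s t x_k - s t x_1`, all of which lie in the join-meet ideal. Conversely,
rewriting monomials by these binomials has an explicit result `normalForm m ≤ m`, which is the same
for `m x_i y_j` and `m s t`; so its linear extension kills the join-meet ideal, which is impossible
for an element whose initial monomial is its own normal form.

In the order `x_1 y_1, …, x_n y_1, x_1 y_2, …, x_n y_2, s t y_2, s t x_2, …, s t x_n` the generators
have linear quotients (`CrystalLattice.linearQuotients`): the ideal of the earlier generators
divided by the next generator `u_k` is generated by a set `A k` of variables. Every `z ∈ A k` gives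
a syzygy `z e_k - w e_j` with `j` earlier than `k`; looking at the leading coordinate, these
generate all syzygies, and looking at linear parts, they do so minimally
(`GradedFree.LinearQuotients.mem_range_syzygyMap`,
`GradedFree.LinearQuotients.constantCoeff_eq_zero_of_syzygyMap_eq_zero`). So `B_{1,j}` counts the
generators of degree `j`, and `B_{2,j}` is the sum of `|A k|` over the generators of degree
`j - 1`: the quadrics contribute `∑_i ((i - 1) + i)`, the cubics `n + ∑_{k ≥ 2} k`.

That these numbers can be read off from an arbitrary minimal graded free resolution is its
uniqueness, proved one step at a time: two minimal graded covers of the same module are isomorphic,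
because the composite of lifts in both directions is the identity modulo the variables, so that its
determinant, homogeneous of degree `0`, is `1`
(`GradedFree.exists_graded_equiv_of_minimal_covers`). Existence follows by covering the successive
syzygy modules with as few homogeneous generators as possible
(`GradedFree.nonempty_minimalGradedFreeResolution`).
-/

open MvPolynomial

/-! ### Graded free modules over a polynomial ring -/

namespace GradedFree

section Graded

variable {σ K : Type*} [Field K]

lemma mem_idealOfVars_iff_constantCoeff {p : MvPolynomial σ K} :
    p ∈ idealOfVars σ K ↔ constantCoeff p = 0 := by
  have h : idealOfVars σ K = Ideal.span (X '' Set.univ) := by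
    rw [idealOfVars, Set.image_univ]
  rw [h, mem_ideal_span_X_image, constantCoeff_eq]
  constructor
  · intro h
    by_contra h0
    obtain ⟨i, -, hi⟩ := h 0 (mem_support_iff.2 h0)
    exact hi rfl
  · intro h m hm
    by_contra! hc
    have : m = 0 := Finsupp.ext fun i => hc i trivial
    exact mem_support_iff.1 hm (this ▸ h)

/-- The homogeneous component of degree `e ∈ ℤ` of a polynomial; it is `0` for `e < 0`. -/
noncomputable def intComponent (e : ℤ) : MvPolynomial σ K →ₗ[K] MvPolynomial σ K :=
  if 0 ≤ e then homogeneousComponent e.toNat else 0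

lemma coeff_intComponent (e : ℤ) (p : MvPolynomial σ K) (m : σ →₀ ℕ) :
    coeff m (intComponent e p) = if (m.degree : ℤ) = e then coeff m p else 0 := by
  unfold intComponent
  split_ifs with h1 h2 h2
  · rw [coeff_homogeneousComponent, if_pos (by omega)]
  · rw [coeff_homogeneousComponent, if_neg (by omega)]
  · omega
  · simp

lemma intComponent_homogeneous (e : ℤ) (p : MvPolynomial σ K) :
    IsHomogeneousOfIntDegree (intComponent e p) e := by
  intro m hm
  rw [mem_support_iff, coeff_intComponent] at hm
  by_contra h
  simp [h] at hm

lemma intComponent_eq_self {e : ℤ} {p : MvPolynomial σ K} (hp : IsHomogeneousOfIntDegree p e) :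
    intComponent e p = p := by
  ext m
  rw [coeff_intComponent]
  split_ifs with h
  · rfl
  · by_contra h0
    exact h (hp m (mem_support_iff.2 (Ne.symm h0)))

lemma intComponent_mul {e z : ℤ} (p : MvPolynomial σ K) {q : MvPolynomial σ K}
    (hq : IsHomogeneousOfIntDegree q e) :
    intComponent z (p * q) = intComponent (z - e) p * q := by
  classical
  ext m
  rw [coeff_intComponent, coeff_mul, coeff_mul]
  split_ifs with h
  · refine Finset.sum_congr rfl fun x hx => ?_
    rw [coeff_intComponent]
    by_cases h0 : coeff x.2 q = 0
    · simp [h0]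
    · have h1 := hq x.2 (mem_support_iff.2 h0)
      have h2 : x.1.degree + x.2.degree = m.degree := by
        rw [← map_add, Finset.HasAntidiagonal.mem_antidiagonal.1 hx]
      rw [if_pos (by omega)]
  · refine (Finset.sum_eq_zero fun x hx => ?_).symm
    rw [coeff_intComponent]
    by_cases h0 : coeff x.2 q = 0
    · simp [h0]
    · have h1 := hq x.2 (mem_support_iff.2 h0)
      have h2 : x.1.degree + x.2.degree = m.degree := by
        rw [← map_add, Finset.HasAntidiagonal.mem_antidiagonal.1 hx]
      rw [if_neg (by omega), zero_mul]

lemma IsHomogeneousOfIntDegree.mul {p q : MvPolynomial σ K} {d e : ℤ}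
    (hp : IsHomogeneousOfIntDegree p d) (hq : IsHomogeneousOfIntDegree q e) :
    IsHomogeneousOfIntDegree (p * q) (d + e) := by
  have := intComponent_homogeneous (d + e) (p * q)
  rwa [intComponent_mul p hq, add_sub_cancel_right, intComponent_eq_self hp] at this

lemma IsHomogeneousOfIntDegree.sum {ι : Type*} {s : Finset ι} {p : ι → MvPolynomial σ K} {e : ℤ}
    (hp : ∀ i ∈ s, IsHomogeneousOfIntDegree (p i) e) :
    IsHomogeneousOfIntDegree (∑ i ∈ s, p i) e := by
  have := intComponent_homogeneous e (∑ i ∈ s, p i)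
  rwa [map_sum, Finset.sum_congr rfl fun i hi => intComponent_eq_self (hp i hi)] at this

lemma homogeneous_C (c : K) : IsHomogeneousOfIntDegree (C c : MvPolynomial σ K) 0 := by
  classical
  intro m hm
  rw [mem_support_iff, coeff_C] at hm
  have : m = 0 := by by_contra h; simp [Ne.symm h] at hm
  simp [this]

lemma homogeneous_zero (e : ℤ) : IsHomogeneousOfIntDegree (0 : MvPolynomial σ K) e := by
  intro m hm; simp at hm

lemma homogeneous_monomial (m : σ →₀ ℕ) (c : K) :
    IsHomogeneousOfIntDegree (monomial m c) m.degree := by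
  classical
  intro m' hm
  rw [mem_support_iff, coeff_monomial] at hm
  have : m = m' := by by_contra h; simp [h] at hm
  rw [this]

lemma IsHomogeneousOfIntDegree.prod {ι : Type*} {s : Finset ι} {p : ι → MvPolynomial σ K}
    {e : ι → ℤ} (hp : ∀ i ∈ s, IsHomogeneousOfIntDegree (p i) (e i)) :
    IsHomogeneousOfIntDegree (∏ i ∈ s, p i) (∑ i ∈ s, e i) := by
  classical
  induction s using Finset.induction_on with
  | empty => simpa using homogeneous_C (σ := σ) (1 : K)
  | insert a s ha ih =>
    rw [Finset.prod_insert ha, Finset.sum_insert ha]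
    exact IsHomogeneousOfIntDegree.mul (hp a (Finset.mem_insert_self a s))
      (ih fun i hi => hp i (Finset.mem_insert_of_mem hi))

lemma eq_C_of_homogeneous_zero {p : MvPolynomial σ K} (hp : IsHomogeneousOfIntDegree p 0) :
    p = C (constantCoeff p) := by
  classical
  ext m
  rw [coeff_C, constantCoeff_eq]
  split_ifs with h
  · rw [h]
  · by_contra h0
    have := hp m (mem_support_iff.2 h0)
    exact h ((Finsupp.degree_eq_zero_iff m).1 (by exact_mod_cast this)).symm

lemma degree_eq_zero_of_constantCoeff_ne {p : MvPolynomial σ K} {e : ℤ}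
    (hp : IsHomogeneousOfIntDegree p e) (h : constantCoeff p ≠ 0) : e = 0 := by
  simpa using (hp 0 (mem_support_iff.2 h)).symm

variable {ι ι' ι'' : Type*}

/-- `v` is homogeneous of degree `e` in the graded free module `⨁_a R(-deg a)`. -/
def IsHomVec (deg : ι → ℤ) (e : ℤ) (v : ι → MvPolynomial σ K) : Prop :=
  ∀ a, IsHomogeneousOfIntDegree (v a) (e - deg a)

/-- The component of degree `e` of an element of the graded free module `⨁_a R(-deg a)`. -/
noncomputable def vecComponent (deg : ι → ℤ) (e : ℤ) :
    (ι → MvPolynomial σ K) →ₗ[K] (ι → MvPolynomial σ K) :=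
  LinearMap.pi fun a => intComponent (e - deg a) ∘ₗ LinearMap.proj a

lemma vecComponent_apply (deg : ι → ℤ) (e : ℤ) (v : ι → MvPolynomial σ K) (a : ι) :
    vecComponent deg e v a = intComponent (e - deg a) (v a) := rfl

lemma vecComponent_homVec (deg : ι → ℤ) (e : ℤ) (v : ι → MvPolynomial σ K) :
    IsHomVec deg e (vecComponent deg e v) := fun _ => intComponent_homogeneous _ _

lemma vecComponent_eq_self {deg : ι → ℤ} {e : ℤ} {v : ι → MvPolynomial σ K}
    (hv : IsHomVec deg e v) : vecComponent deg e v = v :=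
  funext fun a => intComponent_eq_self (hv a)

lemma homVec_single [DecidableEq ι] (deg : ι → ℤ) (b : ι) :
    IsHomVec deg (deg b) (Pi.single b (1 : MvPolynomial σ K)) := by
  intro a
  by_cases h : a = b
  · subst h
    simpa using homogeneous_C (σ := σ) (1 : K)
  · simpa [h] using homogeneous_zero _

lemma exists_eq_sum_vecComponent [Finite ι] (deg : ι → ℤ) (v : ι → MvPolynomial σ K) :
    ∃ E : Finset ℤ, v = ∑ e ∈ E, vecComponent deg e v := by
  classical
  cases nonempty_fintype ι
  refine ⟨Finset.univ.biUnion fun a => (v a).support.image fun m => (m.degree : ℤ) + deg a, ?_⟩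
  ext a m
  rw [Finset.sum_apply, coeff_sum]
  simp_rw [vecComponent_apply, coeff_intComponent]
  by_cases h0 : coeff m (v a) = 0
  · simp [h0]
  rw [Finset.sum_eq_single ((m.degree : ℤ) + deg a)]
  · simp
  · intro b _ hb
    rw [if_neg (by omega)]
  · intro h
    refine absurd (Finset.mem_biUnion.2 ⟨a, Finset.mem_univ _, Finset.mem_image.2
      ⟨m, mem_support_iff.2 h0, rfl⟩⟩) h

lemma map_eq_sum [Fintype ι] [DecidableEq ι] {R M : Type*} [CommRing R] [AddCommGroup M]
    [Module R M] (f : (ι → R) →ₗ[R] M) (v : ι → R) :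
    f v = ∑ b, v b • f (Pi.single b 1) := by
  conv_lhs => rw [pi_eq_sum_univ' v]
  rw [map_sum]
  refine Finset.sum_congr rfl fun b _ => ?_
  rw [map_smul]

/-- An `R`-linear map of graded free modules that preserves degrees. -/
def IsGradedMap [DecidableEq ι] (deg : ι → ℤ) (deg' : ι' → ℤ)
    (f : (ι → MvPolynomial σ K) →ₗ[MvPolynomial σ K] (ι' → MvPolynomial σ K)) : Prop :=
  ∀ b, IsHomVec deg' (deg b) (f (Pi.single b 1))

lemma IsGradedMap.map_vecComponent [Fintype ι] [DecidableEq ι] {deg : ι → ℤ} {deg' : ι' → ℤ}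
    {f : (ι → MvPolynomial σ K) →ₗ[MvPolynomial σ K] (ι' → MvPolynomial σ K)}
    (hf : IsGradedMap deg deg' f) (e : ℤ) (v : ι → MvPolynomial σ K) :
    f (vecComponent deg e v) = vecComponent deg' e (f v) := by
  ext1 a
  rw [map_eq_sum f, map_eq_sum f v, vecComponent_apply, Finset.sum_apply, Finset.sum_apply, map_sum]
  refine Finset.sum_congr rfl fun b _ => ?_
  rw [Pi.smul_apply, Pi.smul_apply, smul_eq_mul, smul_eq_mul, intComponent_mul _ (hf b a),
    vecComponent_apply]
  congr 2
  ring_nf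

lemma IsGradedMap.homVec [Fintype ι] [DecidableEq ι] {deg : ι → ℤ} {deg' : ι' → ℤ}
    {f : (ι → MvPolynomial σ K) →ₗ[MvPolynomial σ K] (ι' → MvPolynomial σ K)}
    (hf : IsGradedMap deg deg' f) {e : ℤ} {v : ι → MvPolynomial σ K} (hv : IsHomVec deg e v) :
    IsHomVec deg' e (f v) := by
  have := vecComponent_homVec deg' e (f v)
  rwa [← hf.map_vecComponent, vecComponent_eq_self hv] at this

lemma IsGradedMap.exists_homVec_preimage [Fintype ι] [DecidableEq ι] {deg : ι → ℤ} {deg' : ι' → ℤ}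
    {f : (ι → MvPolynomial σ K) →ₗ[MvPolynomial σ K] (ι' → MvPolynomial σ K)}
    (hf : IsGradedMap deg deg' f) {e : ℤ} {v : ι' → MvPolynomial σ K} (hv : IsHomVec deg' e v)
    (h : v ∈ LinearMap.range f) : ∃ w, IsHomVec deg e w ∧ f w = v := by
  obtain ⟨w, rfl⟩ := h
  exact ⟨_, vecComponent_homVec deg e w, by rw [hf.map_vecComponent, vecComponent_eq_self hv]⟩

lemma IsGradedMap.comp [Fintype ι'] [DecidableEq ι] [DecidableEq ι'] {deg : ι → ℤ}
    {deg' : ι' → ℤ} {deg'' : ι'' → ℤ}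
    {g : (ι' → MvPolynomial σ K) →ₗ[MvPolynomial σ K] (ι'' → MvPolynomial σ K)}
    {f : (ι → MvPolynomial σ K) →ₗ[MvPolynomial σ K] (ι' → MvPolynomial σ K)}
    (hg : IsGradedMap deg' deg'' g) (hf : IsGradedMap deg deg' f) :
    IsGradedMap deg deg'' (g ∘ₗ f) := fun b => hg.homVec (hf b)

/-- A degree-preserving endomorphism that is the identity modulo the variables is bijective: its
determinant is homogeneous of degree `0`, hence equal to its constant coefficient `1`. -/
lemma IsGradedMap.bijective_of_constantCoeff [Fintype ι] [DecidableEq ι] {deg : ι → ℤ}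
    {f : (ι → MvPolynomial σ K) →ₗ[MvPolynomial σ K] (ι → MvPolynomial σ K)}
    (hf : IsGradedMap deg deg f)
    (h1 : ∀ v a, constantCoeff (f v a) = constantCoeff (v a)) : Function.Bijective f := by
  rw [← Module.End.isUnit_iff, LinearMap.isUnit_iff_isUnit_det, ← LinearMap.det_toMatrix']
  have hM : ∀ i j, LinearMap.toMatrix' f i j = f (Pi.single j 1) i := fun i j => by
    rw [LinearMap.toMatrix'_apply]
  have hdeg : IsHomogeneousOfIntDegree (LinearMap.toMatrix' f).det 0 := by
    rw [Matrix.det_apply']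
    refine IsHomogeneousOfIntDegree.sum fun τ _ => ?_
    have hz : IsHomogeneousOfIntDegree
        (((Equiv.Perm.sign τ : ℤ) : MvPolynomial σ K)) 0 := by
      have := homogeneous_C (σ := σ) ((Equiv.Perm.sign τ : ℤ) : K)
      simpa using this
    have hp : IsHomogeneousOfIntDegree (∏ i, LinearMap.toMatrix' f (τ i) i)
        (∑ i, (deg i - deg (τ i))) := by
      refine IsHomogeneousOfIntDegree.prod fun i _ => ?_
      rw [hM]
      exact hf i (τ i)
    have h0 : ∑ i, (deg i - deg (τ i)) = 0 := by
      rw [Finset.sum_sub_distrib, Equiv.sum_comp τ deg, sub_self]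
    rw [h0] at hp
    simpa using IsHomogeneousOfIntDegree.mul hz hp
  have hc : constantCoeff (LinearMap.toMatrix' f).det = 1 := by
    rw [RingHom.map_det]
    have : (constantCoeff (R := K) (σ := σ)).mapMatrix (LinearMap.toMatrix' f) = 1 := by
      ext i j
      rw [RingHom.mapMatrix_apply, Matrix.map_apply, hM, h1]
      by_cases h : i = j
      · subst h; simp
      · simp [h]
    rw [this, Matrix.det_one]
  rw [eq_C_of_homogeneous_zero hdeg, hc, C_1]
  exact isUnit_one

/-- Two minimal graded free covers of the same graded module are isomorphic. The common target `M`
carries no grading here: what is used of it is that the image of each basis element under one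
cover has a homogeneous preimage of the same degree under the other. -/
lemma exists_graded_equiv_of_minimal_covers [Fintype ι] [DecidableEq ι] [Fintype ι']
    [DecidableEq ι'] {deg : ι → ℤ} {deg' : ι' → ℤ} {M : Type*} [AddCommGroup M]
    [Module (MvPolynomial σ K) M]
    (φ : (ι → MvPolynomial σ K) →ₗ[MvPolynomial σ K] M)
    (φ' : (ι' → MvPolynomial σ K) →ₗ[MvPolynomial σ K] M)
    (h1 : ∀ b, ∃ w, IsHomVec deg' (deg b) w ∧ φ' w = φ (Pi.single b 1))
    (h2 : ∀ b, ∃ w, IsHomVec deg (deg' b) w ∧ φ w = φ' (Pi.single b 1))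
    (k1 : ∀ v, φ v = 0 → ∀ a, constantCoeff (v a) = 0)
    (k2 : ∀ v, φ' v = 0 → ∀ a, constantCoeff (v a) = 0) :
    ∃ Θ : (ι → MvPolynomial σ K) ≃ₗ[MvPolynomial σ K] (ι' → MvPolynomial σ K),
      IsGradedMap deg deg' Θ.toLinearMap ∧ ∀ v, φ' (Θ v) = φ v := by
  choose A hA hA' using h1
  choose B hB hB' using h2
  let α := Fintype.linearCombination (MvPolynomial σ K) A
  let β := Fintype.linearCombination (MvPolynomial σ K) B
  have hα : ∀ b, α (Pi.single b 1) = A b := fun b => by simp [α]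
  have hβ : ∀ b, β (Pi.single b 1) = B b := fun b => by simp [β]
  have gα : IsGradedMap deg deg' α := fun b => by rw [hα]; exact hA b
  have gβ : IsGradedMap deg' deg β := fun b => by rw [hβ]; exact hB b
  have cα : ∀ v, φ' (α v) = φ v := fun v => by
    rw [map_eq_sum φ v, map_eq_sum α v, map_sum]
    exact Finset.sum_congr rfl fun b _ => by rw [map_smul, hα, hA']
  have cβ : ∀ v, φ (β v) = φ' v := fun v => by
    rw [map_eq_sum φ' v, map_eq_sum β v, map_sum]
    exact Finset.sum_congr rfl fun b _ => by rw [map_smul, hβ, hB']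
  have b1 : Function.Bijective (β ∘ₗ α) := by
    refine (gβ.comp gα).bijective_of_constantCoeff fun v a => ?_
    have := k1 (β (α v) - v) (by rw [map_sub, cβ, cα, sub_self]) a
    rwa [Pi.sub_apply, map_sub, sub_eq_zero] at this
  have b2 : Function.Bijective (α ∘ₗ β) := by
    refine (gα.comp gβ).bijective_of_constantCoeff fun v a => ?_
    have := k2 (α (β v) - v) (by rw [map_sub, cα, cβ, sub_self]) a
    rwa [Pi.sub_apply, map_sub, sub_eq_zero] at this
  refine ⟨LinearEquiv.ofBijective α ⟨?_, ?_⟩, gα, cα⟩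
  · exact Function.Injective.of_comp (f := β) (by simpa using b1.1)
  · exact Function.Surjective.of_comp (g := β) (by simpa using b2.2)

lemma IsGradedMap.symm [Fintype ι] [DecidableEq ι] [DecidableEq ι'] {deg : ι → ℤ} {deg' : ι' → ℤ}
    {Θ : (ι → MvPolynomial σ K) ≃ₗ[MvPolynomial σ K] (ι' → MvPolynomial σ K)}
    (h : IsGradedMap deg deg' Θ.toLinearMap) : IsGradedMap deg' deg Θ.symm.toLinearMap := by
  intro b
  obtain ⟨w, hw, hw'⟩ := h.exists_homVec_preimage (homVec_single deg' b)
    ⟨Θ.symm (Pi.single b 1), by simp⟩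
  have : Θ.symm (Pi.single b 1) = w := by rw [LinearEquiv.symm_apply_eq]; exact hw'.symm
  simpa [this] using hw

lemma constantCoeff_block_mul_block_symm [Fintype ι] [DecidableEq ι] [Fintype ι']
    [DecidableEq ι'] {deg : ι → ℤ} {deg' : ι' → ℤ}
    {Θ : (ι → MvPolynomial σ K) ≃ₗ[MvPolynomial σ K] (ι' → MvPolynomial σ K)}
    (h : IsGradedMap deg deg' Θ.toLinearMap) (j : ℤ) :
    (Matrix.of fun (a : {a // deg a = j}) (b : {b // deg' b = j}) =>
      constantCoeff (Θ.symm (Pi.single b.1 1) a.1)) *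
    (Matrix.of fun (b : {b // deg' b = j}) (a : {a // deg a = j}) =>
      constantCoeff (Θ (Pi.single a.1 1) b.1)) = 1 := by
  ext ⟨a, ha⟩ ⟨a', ha'⟩
  rw [Matrix.mul_apply]
  simp only [Matrix.of_apply]
  have e1 : Θ.symm (Θ (Pi.single a' 1)) a = ∑ b, Θ (Pi.single a' 1) b *
      Θ.symm (Pi.single b 1) a := by
    have := congrFun (map_eq_sum Θ.symm.toLinearMap (Θ (Pi.single a' 1))) a
    simpa using this
  rw [LinearEquiv.symm_apply_apply] at e1
  have e2 := congrArg constantCoeff e1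
  rw [map_sum] at e2
  have e3 : ∑ b, constantCoeff (Θ (Pi.single a' 1) b * Θ.symm (Pi.single b 1) a) =
      ∑ b ∈ Finset.univ.filter (fun b => deg' b = j),
        constantCoeff (Θ (Pi.single a' 1) b * Θ.symm (Pi.single b 1) a) := by
    refine (Finset.sum_filter_of_ne fun b _ hb => ?_).symm
    rw [map_mul] at hb
    have := degree_eq_zero_of_constantCoeff_ne (h a' b) (left_ne_zero_of_mul hb)
    omega
  rw [e3, ← Finset.sum_subtype_of_mem (p := fun b => deg' b = j)
    (fun b => constantCoeff (Θ (Pi.single a' 1) b * Θ.symm (Pi.single b 1) a))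
    (by simp)] at e2
  have e4 : (Finset.univ.filter (fun b => deg' b = j)).subtype (fun b => deg' b = j) =
      Finset.univ := by
    ext b
    simpa using b.2
  rw [e4] at e2
  simp_rw [map_mul] at e2
  simp_rw [mul_comm (constantCoeff (Θ.symm _ _))]
  rw [← e2]
  by_cases hh : a = a'
  · subst hh; simp
  · simp [hh]

/-- Graded isomorphic graded free modules have the same number of generators in each degree: modulo
the variables, the isomorphism is a block diagonal invertible matrix over `K`. -/
lemma card_filter_deg_eq_of_graded_equiv [Fintype ι] [DecidableEq ι] [Fintype ι']
    [DecidableEq ι'] {deg : ι → ℤ} {deg' : ι' → ℤ}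
    {Θ : (ι → MvPolynomial σ K) ≃ₗ[MvPolynomial σ K] (ι' → MvPolynomial σ K)}
    (h : IsGradedMap deg deg' Θ.toLinearMap) (j : ℤ) :
    (Finset.univ.filter fun b => deg b = j).card =
      (Finset.univ.filter fun b => deg' b = j).card := by
  have m1 := constantCoeff_block_mul_block_symm h j
  have m2 := constantCoeff_block_mul_block_symm (IsGradedMap.symm h) j
  rw [LinearEquiv.symm_symm] at m2
  have := Matrix.square_of_invertible _ _ m1 m2
  rw [Fintype.card_subtype, Fintype.card_subtype] at this
  exact this

end Graded

end GradedFree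

namespace GradedFree

/-! ### Existence of minimal graded free resolutions -/

section Existence

variable {σ K : Type*} [Field K] {ι ι' : Type*}

/-- A graded submodule of the graded free module `⨁_a R(-deg a)`: it contains the homogeneous
components of its elements. -/
def IsHomSubmodule (deg : ι → ℤ) (N : Submodule (MvPolynomial σ K) (ι → MvPolynomial σ K)) : Prop :=
  ∀ v ∈ N, ∀ e, vecComponent deg e v ∈ N

lemma IsGradedMap.isHomSubmodule_ker [Fintype ι] [DecidableEq ι] {deg : ι → ℤ} {deg' : ι' → ℤ}
    {f : (ι → MvPolynomial σ K) →ₗ[MvPolynomial σ K] (ι' → MvPolynomial σ K)}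
    (hf : IsGradedMap deg deg' f) : IsHomSubmodule deg (LinearMap.ker f) := by
  intro v hv e
  rw [LinearMap.mem_ker] at hv ⊢
  rw [hf.map_vecComponent, hv, map_zero]

lemma exists_graded_map_range_eq [Finite σ] [Finite ι] {deg : ι → ℤ}
    {N : Submodule (MvPolynomial σ K) (ι → MvPolynomial σ K)} (hN : IsHomSubmodule deg N) :
    ∃ (r : ℕ) (d : Fin r → ℤ)
      (φ : (Fin r → MvPolynomial σ K) →ₗ[MvPolynomial σ K] (ι → MvPolynomial σ K)),
      IsGradedMap d deg φ ∧ LinearMap.range φ = N := by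
  have hspan : Submodule.span (MvPolynomial σ K) {v | v ∈ N ∧ ∃ e, IsHomVec deg e v} = N := by
    refine le_antisymm (Submodule.span_le.2 fun v hv => hv.1) fun v hv => ?_
    obtain ⟨E, hE⟩ := exists_eq_sum_vecComponent deg v
    rw [hE]
    exact Submodule.sum_mem _ fun e _ =>
      Submodule.subset_span ⟨hN v hv e, e, vecComponent_homVec deg e v⟩
  have hfg : N.FG := IsNoetherian.noetherian N
  rw [← hspan, Submodule.fg_span_iff_fg_span_finset_subset, hspan] at hfg
  obtain ⟨s, hs, hsN⟩ := hfg
  have hd : ∀ i : Fin s.card, ∃ e, IsHomVec deg e (s.equivFin.symm i).1 :=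
    fun i => (hs (s.equivFin.symm i).2).2
  choose d hd using hd
  refine ⟨s.card, d, Fintype.linearCombination _ fun i => (s.equivFin.symm i).1, fun b => ?_, ?_⟩
  · simpa using hd b
  · rw [Fintype.range_linearCombination, hsN]
    congr 1
    ext v
    constructor
    · rintro ⟨i, rfl⟩
      exact (s.equivFin.symm i).2
    · intro hv
      exact ⟨s.equivFin ⟨v, hv⟩, by simp⟩

/-- A generator with a unit coefficient in some relation is redundant: taking the component of the
relation in the degree of that generator turns the unit into a nonzero constant. -/
lemma exists_graded_map_of_constantCoeff_ne [DecidableEq ι] {deg : ι → ℤ} {r : ℕ}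
    {d : Fin (r + 1) → ℤ}
    {φ : (Fin (r + 1) → MvPolynomial σ K) →ₗ[MvPolynomial σ K] (ι → MvPolynomial σ K)}
    (hφ : IsGradedMap d deg φ) {v : Fin (r + 1) → MvPolynomial σ K} (hv : φ v = 0)
    {a : Fin (r + 1)} (ha : constantCoeff (v a) ≠ 0) :
    ∃ (d' : Fin r → ℤ)
      (φ' : (Fin r → MvPolynomial σ K) →ₗ[MvPolynomial σ K] (ι → MvPolynomial σ K)),
      IsGradedMap d' deg φ' ∧ LinearMap.range φ' = LinearMap.range φ := by
  set w := vecComponent d (d a) v with hw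
  have hφw : φ w = 0 := by rw [hw, hφ.map_vecComponent, hv, map_zero]
  have hwa : w a = C (constantCoeff (v a)) := by
    have h0 : IsHomogeneousOfIntDegree (w a) 0 := by
      simpa using vecComponent_homVec d (d a) v a
    rw [eq_C_of_homogeneous_zero h0, hw, vecComponent_apply, constantCoeff_eq,
      coeff_intComponent]
    simp
  refine ⟨fun i => d (a.succAbove i),
    Fintype.linearCombination _ fun i => φ (Pi.single (a.succAbove i) 1), fun b => ?_, ?_⟩
  · simpa using hφ (a.succAbove b)
  · rw [Fintype.range_linearCombination]
    apply le_antisymm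
    · rw [Submodule.span_le]
      rintro _ ⟨i, rfl⟩
      exact ⟨_, rfl⟩
    · have hother : ∀ i, φ (Pi.single (a.succAbove i) 1) ∈ Submodule.span (MvPolynomial σ K)
          (Set.range fun i => φ (Pi.single (a.succAbove i) 1)) :=
        fun i => Submodule.subset_span ⟨i, rfl⟩
      have hself : φ (Pi.single a 1) ∈ Submodule.span (MvPolynomial σ K)
          (Set.range fun i => φ (Pi.single (a.succAbove i) 1)) := by
        rw [map_eq_sum, Fin.sum_univ_succAbove _ a, hwa] at hφw
        have h1 := eq_neg_of_add_eq_zero_left hφw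
        have h2 : φ (Pi.single a 1) = (C (constantCoeff (v a))⁻¹ : MvPolynomial σ K) •
            ((C (constantCoeff (v a)) : MvPolynomial σ K) • φ (Pi.single a 1)) := by
          rw [smul_smul, ← C_mul, inv_mul_cancel₀ ha, C_1, one_smul]
        rw [h2, h1]
        exact Submodule.smul_mem _ _ (Submodule.neg_mem _
          (Submodule.sum_mem _ fun i _ => Submodule.smul_mem _ _ (hother i)))
      rintro _ ⟨u, rfl⟩
      rw [map_eq_sum]
      refine Submodule.sum_mem _ fun b _ => Submodule.smul_mem _ _ ?_
      rcases eq_or_ne b a with rfl | hb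
      · exact hself
      · obtain ⟨i, rfl⟩ := Fin.exists_succAbove_eq hb
        exact hother i

/-- A graded submodule of a finite graded free module has a minimal graded free cover: one whose
kernel has all its coordinates in the ideal of the variables. -/
lemma exists_minimal_cover [Finite σ] [Finite ι] {deg : ι → ℤ}
    {N : Submodule (MvPolynomial σ K) (ι → MvPolynomial σ K)} (hN : IsHomSubmodule deg N) :
    ∃ (r : ℕ) (d : Fin r → ℤ)
      (φ : (Fin r → MvPolynomial σ K) →ₗ[MvPolynomial σ K] (ι → MvPolynomial σ K)),
      IsGradedMap d deg φ ∧ LinearMap.range φ = N ∧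
        ∀ v ∈ LinearMap.ker φ, ∀ a, constantCoeff (v a) = 0 := by
  classical
  have hex := exists_graded_map_range_eq hN
  obtain ⟨d, φ, hφ, hr⟩ := Nat.find_spec hex
  have hmin := fun m => Nat.find_min (m := m) hex
  revert d φ hmin
  generalize Nat.find hex = r
  intro d φ hφ hr hmin
  refine ⟨r, d, φ, hφ, hr, fun v hv a => ?_⟩
  by_contra h0
  cases r with
  | zero => exact a.elim0
  | succ r =>
    obtain ⟨d', φ', h1, h2⟩ := exists_graded_map_of_constantCoeff_ne hφ hv h0
    exact hmin r (Nat.lt_succ_self r) ⟨d', φ', h1, h2.trans hr⟩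

variable (σ K) in
/-- A graded submodule `N ⊆ 𝔪 F` of a finite graded free module `F`, `𝔪` the ideal of the
variables: what remains to be resolved at one stage of a minimal free resolution. -/
structure SyzygyModule where
  /-- the rank of `F` -/
  rank : ℕ
  /-- the degrees of the basis of `F` -/
  deg : Fin rank → ℤ
  /-- the submodule -/
  N : Submodule (MvPolynomial σ K) (Fin rank → MvPolynomial σ K)
  isHom : IsHomSubmodule deg N
  minimal : ∀ v ∈ N, ∀ a, constantCoeff (v a) = 0

namespace SyzygyModule

variable [Finite σ] (s : SyzygyModule σ K)

/-- The rank of a chosen minimal cover of `N`. -/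
noncomputable def coverRank : ℕ := (exists_minimal_cover s.isHom).choose

/-- The degrees of the generators in a chosen minimal cover of `N`. -/
noncomputable def coverDeg : Fin s.coverRank → ℤ :=
  (exists_minimal_cover s.isHom).choose_spec.choose

/-- A chosen minimal cover of `N`. -/
noncomputable def cover :
    (Fin s.coverRank → MvPolynomial σ K) →ₗ[MvPolynomial σ K] (Fin s.rank → MvPolynomial σ K) :=
  (exists_minimal_cover s.isHom).choose_spec.choose_spec.choose

lemma cover_spec : IsGradedMap s.coverDeg s.deg s.cover ∧ LinearMap.range s.cover = s.N ∧
    ∀ v ∈ LinearMap.ker s.cover, ∀ a, constantCoeff (v a) = 0 :=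
  (exists_minimal_cover s.isHom).choose_spec.choose_spec.choose_spec

/-- The first syzygy module of `N`. -/
noncomputable def next : SyzygyModule σ K where
  rank := s.coverRank
  deg := s.coverDeg
  N := LinearMap.ker s.cover
  isHom := s.cover_spec.1.isHomSubmodule_ker
  minimal := s.cover_spec.2.2

/-- The iterated syzygy modules. -/
noncomputable def iter : ℕ → SyzygyModule σ K
  | 0 => s
  | i + 1 => (iter i).next

end SyzygyModule

/-- A homogeneous ideal of positive elements has a minimal graded free resolution. -/
theorem nonempty_minimalGradedFreeResolution [Finite σ] {J : Ideal (MvPolynomial σ K)}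
    (hJ : ∀ p ∈ J, ∀ e, intComponent e p ∈ J) (hJm : ∀ p ∈ J, constantCoeff p = 0) :
    Nonempty (MinimalGradedFreeResolution J) := by
  let s : SyzygyModule σ K :=
    { rank := 1
      deg := 0
      N := Submodule.comap (LinearMap.proj 0) J
      isHom := fun v hv e => by
        have := hJ (v 0) hv e
        simpa [vecComponent_apply] using this
      minimal := fun v hv a => by
        rw [Subsingleton.elim a 0]
        exact hJm _ hv }
  have hex : ∀ i, LinearMap.range (s.iter (i + 1)).cover = LinearMap.ker (s.iter i).cover :=
    fun i => (s.iter (i + 1)).cover_spec.2.1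
  exact ⟨
    { rank := fun i => (s.iter i).rank
      deg := fun i => (s.iter i).deg
      aug := J.mkQ ∘ₗ (LinearMap.proj (0 : Fin 1) :
        (Fin 1 → MvPolynomial σ K) →ₗ[MvPolynomial σ K] MvPolynomial σ K)
      d := fun i => (s.iter i).cover
      aug_homogeneous := fun a => by
        refine ⟨1, homogeneous_C (σ := σ) (1 : K), ?_⟩
        have ha : a = (0 : Fin 1) := Subsingleton.elim (α := Fin 1) a 0
        subst ha
        change J.mkQ ((Pi.single (0 : Fin 1) (1 : MvPolynomial σ K) : Fin 1 → _) 0) = _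
        rw [Pi.single_eq_same]
        rfl
      d_homogeneous := fun i => (s.iter i).cover_spec.1
      aug_surjective := fun x => by
        obtain ⟨p, rfl⟩ := Ideal.Quotient.mk_surjective x
        exact ⟨fun _ => p, rfl⟩
      exact_zero := fun v => by
        have h0 : v ∈ LinearMap.range (s.iter 0).cover ↔ v ∈ s.N := by
          rw [(s.iter 0).cover_spec.2.1]; rfl
        refine Iff.trans ?_ h0.symm
        exact Ideal.Quotient.eq_zero_iff_mem
      exact_succ := fun i v => by
        change _ ↔ v ∈ LinearMap.range (s.iter (i + 1)).cover
        rw [hex]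
        rfl
      minimal := fun i v a => by
        rw [mem_idealOfVars_iff_constantCoeff]
        refine (s.iter i).minimal _ ?_ a
        rw [← (s.iter i).cover_spec.2.1]
        exact ⟨v, rfl⟩ }⟩

end Existence

/-! ### Uniqueness of minimal graded free resolutions -/

section Uniqueness

variable {σ K : Type*} [Field K] {J : Ideal (MvPolynomial σ K)}

lemma constantCoeff_eq_zero_of_d_eq_zero (S : MinimalGradedFreeResolution J) (i : ℕ)
    {v : Fin (S.rank (i + 1)) → MvPolynomial σ K} (hv : S.d i v = 0) (a : Fin (S.rank (i + 1))) :
    constantCoeff (v a) = 0 := by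
  obtain ⟨u, rfl⟩ := (S.exact_succ i v).1 hv
  exact mem_idealOfVars_iff_constantCoeff.1 (S.minimal (i + 1) u a)

/-- The free module `F_0` of a minimal graded free resolution of `R/J` is `R`. -/
lemma exists_graded_equiv_zero (hJ : ∀ p ∈ J, ∀ e, intComponent e p ∈ J)
    (hJm : ∀ p ∈ J, constantCoeff p = 0) (S : MinimalGradedFreeResolution J) :
    ∃ Θ : (Fin (S.rank 0) → MvPolynomial σ K) ≃ₗ[MvPolynomial σ K] (Unit → MvPolynomial σ K),
      IsGradedMap (S.deg 0) 0 Θ.toLinearMap ∧ ∀ v, S.aug v = Ideal.Quotient.mk J (Θ v ()) := by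
  choose p hp hp' using S.aug_homogeneous
  have haug : ∀ v, S.aug v = Ideal.Quotient.mk J (∑ b, v b * p b) := fun v => by
    rw [map_eq_sum, map_sum]
    refine Finset.sum_congr rfl fun b _ => ?_
    rw [hp']
    rfl
  obtain ⟨Θ, h1, h2⟩ := exists_graded_equiv_of_minimal_covers (deg := S.deg 0)
    (deg' := (0 : Unit → ℤ)) S.aug
    (J.mkQ ∘ₗ (LinearMap.proj () : (Unit → MvPolynomial σ K) →ₗ[MvPolynomial σ K] _))
    (fun b => ⟨fun _ => p b, fun _ => by simpa using hp b, (hp' b).symm⟩)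
    (fun b => by
      obtain ⟨v, hv⟩ := S.aug_surjective (Ideal.Quotient.mk J 1)
      -- As `J` is homogeneous, the component of degree `0` of a preimage of `1` is still one.
      refine ⟨_, vecComponent_homVec _ _ v, ?_⟩
      have hb : (J.mkQ ∘ₗ (LinearMap.proj () : (Unit → MvPolynomial σ K) →ₗ[MvPolynomial σ K] _))
          (Pi.single b 1) = Ideal.Quotient.mk J 1 := by
        change J.mkQ ((Pi.single b (1 : MvPolynomial σ K) : Unit → _) ()) = _
        rw [Subsingleton.elim b (), Pi.single_eq_same]
        rfl
      rw [hb]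
      rw [haug, Ideal.Quotient.eq] at hv ⊢
      have := hJ _ hv 0
      rw [map_sub, map_sum] at this
      convert this using 2
      · refine Finset.sum_congr rfl fun a _ => ?_
        rw [intComponent_mul _ (hp a)]
        rfl
      · exact (intComponent_eq_self (by simpa using homogeneous_C (σ := σ) (1 : K))).symm)
    (fun v hv a => by
      obtain ⟨u, rfl⟩ := (S.exact_zero v).1 hv
      exact mem_idealOfVars_iff_constantCoeff.1 (S.minimal 0 u a))
    (fun v hv a => hJm _ (Ideal.Quotient.eq_zero_iff_mem.1 hv))
  exact ⟨Θ, h1, fun v => (h2 v).symm⟩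

/-- One step of the uniqueness of minimal graded free resolutions. -/
lemma exists_graded_equiv_succ (S : MinimalGradedFreeResolution J) (i : ℕ) {ι κ : Type*} [Fintype ι]
    [DecidableEq ι] [Fintype κ] [DecidableEq κ] {deg : ι → ℤ} {deg' : κ → ℤ}
    {Θ : (Fin (S.rank i) → MvPolynomial σ K) ≃ₗ[MvPolynomial σ K] (ι → MvPolynomial σ K)}
    (hΘ : IsGradedMap (S.deg i) deg Θ.toLinearMap)
    {δ : (κ → MvPolynomial σ K) →ₗ[MvPolynomial σ K] (ι → MvPolynomial σ K)}
    (hδ : IsGradedMap deg' deg δ)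
    (hker : ∀ v, δ v = 0 → ∀ a, constantCoeff (v a) = 0)
    (hrange : ∀ v, Θ v ∈ LinearMap.range δ ↔ v ∈ LinearMap.range (S.d i)) :
    ∃ Θ' : (Fin (S.rank (i + 1)) → MvPolynomial σ K) ≃ₗ[MvPolynomial σ K] (κ → MvPolynomial σ K),
      IsGradedMap (S.deg (i + 1)) deg' Θ'.toLinearMap ∧ ∀ v, δ (Θ' v) = Θ (S.d i v) := by
  have hd : IsGradedMap (S.deg (i + 1)) (S.deg i) (S.d i) := S.d_homogeneous i
  have hΘd : IsGradedMap (S.deg (i + 1)) deg (Θ.toLinearMap ∘ₗ S.d i) := hΘ.comp hd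
  refine exists_graded_equiv_of_minimal_covers (Θ.toLinearMap ∘ₗ S.d i) δ
    (fun b => hδ.exists_homVec_preimage (hΘd b) ((hrange _).2 ⟨_, rfl⟩))
    (fun b => hΘd.exists_homVec_preimage (hδ b) ?_) ?_ hker
  · obtain ⟨u, hu⟩ := (hrange (Θ.symm (δ (Pi.single b 1)))).1 (by simp)
    exact ⟨u, by simp [hu]⟩
  · intro v hv
    exact constantCoeff_eq_zero_of_d_eq_zero S i (by simpa using hv)

/-- The first two rows of Betti numbers can be read off from any minimal graded presentation
`R^κ → R^ι → R` of `R/J` whose second map has its kernel in `𝔪 R^κ`. -/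
theorem betti_eq_of_minimal_presentation (hJ : ∀ p ∈ J, ∀ e, intComponent e p ∈ J)
    (hJm : ∀ p ∈ J, constantCoeff p = 0) {ι κ : Type*} [Fintype ι]
    [DecidableEq ι] [Fintype κ] [DecidableEq κ] {deg : ι → ℤ} {deg' : κ → ℤ}
    {δ₁ : (ι → MvPolynomial σ K) →ₗ[MvPolynomial σ K] (Unit → MvPolynomial σ K)}
    {δ₂ : (κ → MvPolynomial σ K) →ₗ[MvPolynomial σ K] (ι → MvPolynomial σ K)}
    (g₁ : IsGradedMap deg 0 δ₁) (g₂ : IsGradedMap deg' deg δ₂)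
    (r₁ : ∀ v, v ∈ LinearMap.range δ₁ ↔ v () ∈ J)
    (r₂ : ∀ v, v ∈ LinearMap.range δ₂ ↔ δ₁ v = 0)
    (k₁ : ∀ v, δ₁ v = 0 → ∀ a, constantCoeff (v a) = 0)
    (k₂ : ∀ v, δ₂ v = 0 → ∀ a, constantCoeff (v a) = 0)
    (S : MinimalGradedFreeResolution J) (j : ℤ) :
    S.betti 1 j = (Finset.univ.filter fun b => deg b = j).card ∧
    S.betti 2 j = (Finset.univ.filter fun b => deg' b = j).card := by
  obtain ⟨Θ₀, h₀, c₀⟩ := exists_graded_equiv_zero hJ hJm S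
  obtain ⟨Θ₁, h₁, c₁⟩ := exists_graded_equiv_succ S 0 h₀ g₁ k₁ fun v => by
    rw [r₁, ← Ideal.Quotient.eq_zero_iff_mem, ← c₀]
    exact S.exact_zero v
  obtain ⟨Θ₂, h₂, -⟩ := exists_graded_equiv_succ S 1 h₁ g₂ k₂ fun v => by
    rw [r₂, c₁, LinearEquiv.map_eq_zero_iff]
    exact S.exact_succ 0 v
  exact ⟨card_filter_deg_eq_of_graded_equiv h₁ j, card_filter_deg_eq_of_graded_equiv h₂ j⟩

end Uniqueness

end GradedFree

/-! ### Monomial ideals with linear quotients -/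

namespace GradedFree

section LinearQuotients

variable {σ K : Type*} [Field K] {ι : Type*}

variable (K) in
/-- The map `R^ι → R` sending the `k`-th basis element to the monomial with exponent `u k`; the
target is written as functions on `Unit` to have it among the graded free modules. -/
noncomputable def generatorMap [Fintype ι] (u : ι → σ →₀ ℕ) :
    (ι → MvPolynomial σ K) →ₗ[MvPolynomial σ K] (Unit → MvPolynomial σ K) :=
  Fintype.linearCombination _ fun k _ => monomial (u k) 1

lemma generatorMap_apply [Fintype ι] {u : ι → σ →₀ ℕ} (v : ι → MvPolynomial σ K) :
    generatorMap K u v () = ∑ k, v k * monomial (u k) 1 := by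
  simp [generatorMap, Fintype.linearCombination_apply]

lemma mem_range_generatorMap [Fintype ι] {u : ι → σ →₀ ℕ} (v : Unit → MvPolynomial σ K) :
    v ∈ LinearMap.range (generatorMap K u) ↔
      v () ∈ Ideal.span ((fun m => monomial m (1 : K)) '' Set.range u) := by
  rw [← Set.range_comp, Ideal.mem_span_range_iff_exists_fun]
  constructor
  · rintro ⟨w, rfl⟩
    exact ⟨w, (generatorMap_apply w).symm⟩
  · rintro ⟨w, hw⟩
    exact ⟨w, funext fun _ => (generatorMap_apply w).trans hw⟩

lemma intComponent_mem_span_monomial {T : Set (σ →₀ ℕ)} {p : MvPolynomial σ K}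
    (hp : p ∈ Ideal.span ((fun m => monomial m (1 : K)) '' T)) (e : ℤ) :
    intComponent e p ∈ Ideal.span ((fun m => monomial m (1 : K)) '' T) := by
  rw [mem_ideal_span_monomial_image] at hp ⊢
  intro m hm
  refine hp m ?_
  rw [mem_support_iff, coeff_intComponent] at hm
  exact mem_support_iff.2 fun h => hm (by simp [h])

lemma constantCoeff_eq_zero_of_mem_span_monomial {u : ι → σ →₀ ℕ} (hu : ∀ k, u k ≠ 0)
    {p : MvPolynomial σ K}
    (hp : p ∈ Ideal.span ((fun m => monomial m (1 : K)) '' Set.range u)) :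
    constantCoeff p = 0 := by
  rw [mem_ideal_span_monomial_image] at hp
  by_contra h0
  obtain ⟨_, ⟨k, rfl⟩, hle⟩ := hp 0 (mem_support_iff.2 h0)
  exact hu k (le_antisymm hle zero_le)

theorem nonempty_resolution_span_monomial [Finite σ] {u : ι → σ →₀ ℕ} (hu : ∀ k, u k ≠ 0) :
    Nonempty (MinimalGradedFreeResolution
      (Ideal.span ((fun m => monomial m (1 : K)) '' Set.range u))) :=
  nonempty_minimalGradedFreeResolution (fun _ hp e => intComponent_mem_span_monomial hp e)
    fun _ hp => constantCoeff_eq_zero_of_mem_span_monomial hu hp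

lemma coeff_single_mul_eq_zero {p q : MvPolynomial σ K} (hp : constantCoeff p = 0)
    (hq : constantCoeff q = 0) (z : σ) : coeff (Finsupp.single z 1) (p * q) = 0 := by
  classical
  rw [coeff_mul]
  refine Finset.sum_eq_zero fun x hx => ?_
  have h := congrArg Finsupp.degree (Finset.HasAntidiagonal.mem_antidiagonal.1 hx)
  rw [map_add, Finsupp.degree_single] at h
  rcases Nat.eq_zero_or_pos x.1.degree with h1 | h1
  · rw [(Finsupp.degree_eq_zero_iff _).1 h1, ← constantCoeff_eq, hp, zero_mul]
  · have h2 : x.2.degree = 0 := by omega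
    rw [(Finsupp.degree_eq_zero_iff _).1 h2, ← constantCoeff_eq, hq, mul_zero]

/-- The combinatorial form of linear quotients for a family `u` of monomials, totally ordered by
`pos`: the ideal of those `f` for which `f u_k` lies in the ideal of the earlier monomials is
generated by a set `A k` of variables. `target` records, for each `z ∈ A k`, an earlier monomial
dividing `z u_k`. -/
structure LinearQuotients (u : ι → σ →₀ ℕ) where
  /-- the position of a monomial in the order -/
  pos : ι → ℕ
  pos_injective : Function.Injective pos
  /-- the variables generating the colon ideal -/
  A : ι → Finset σ
  /-- an earlier monomial dividing `z u_k` -/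
  target : (Σ k, A k) → ι
  pos_target_lt : ∀ c, pos (target c) < pos c.1
  target_le : ∀ c, u (target c) ≤ u c.1 + Finsupp.single (c.2 : σ) 1
  target_ne : ∀ c, u (target c) ≠ u c.1 + Finsupp.single (c.2 : σ) 1
  exists_mem_lt : ∀ j k, pos j < pos k → ∃ z ∈ A k, u k z < u j z

namespace LinearQuotients

variable {u : ι → σ →₀ ℕ} (Q : LinearQuotients u)

/-- The cofactor of the target of `z u_k`. -/
noncomputable def cofactor (c : Σ k, Q.A k) : σ →₀ ℕ :=
  u c.1 + Finsupp.single (c.2 : σ) 1 - u (Q.target c)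

lemma cofactor_add (c : Σ k, Q.A k) :
    Q.cofactor c + u (Q.target c) = u c.1 + Finsupp.single (c.2 : σ) 1 :=
  tsub_add_cancel_of_le (Q.target_le c)

lemma cofactor_ne_zero (c : Σ k, Q.A k) : Q.cofactor c ≠ 0 := fun h => by
  have := Q.cofactor_add c
  rw [h, zero_add] at this
  exact Q.target_ne c this

variable (K) [DecidableEq ι]

/-- The syzygy `z e_k - w e_j` coming from `z u_k = w u_j`. -/
noncomputable def syzygy (c : Σ k, Q.A k) : ι → MvPolynomial σ K :=
  Pi.single c.1 (X (c.2 : σ)) - Pi.single (Q.target c) (monomial (Q.cofactor c) 1)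

variable {K}

lemma constantCoeff_syzygy (c : Σ k, Q.A k) (a : ι) : constantCoeff (Q.syzygy K c a) = 0 := by
  have h1 := Q.cofactor_ne_zero c
  have h2 : constantCoeff (monomial (Q.cofactor c) (1 : K)) = 0 := by
    classical
    rw [constantCoeff_eq, coeff_monomial, if_neg h1]
  simp only [syzygy, Pi.sub_apply, Pi.single_apply, map_sub]
  split_ifs <;> simp [h2]

variable (K) [Fintype ι]

/-- The map onto the module of syzygies of the monomials `u k`. -/
noncomputable def syzygyMap :
    ((Σ k, Q.A k) → MvPolynomial σ K) →ₗ[MvPolynomial σ K] (ι → MvPolynomial σ K) :=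
  Fintype.linearCombination _ (Q.syzygy K)

variable {K}

lemma generatorMap_single (k : ι) :
    generatorMap K u (Pi.single k 1) = fun _ => monomial (u k) 1 := by
  simp [generatorMap]

lemma syzygyMap_single [DecidableEq (Σ k, Q.A k)] (c : Σ k, Q.A k) :
    Q.syzygyMap K (Pi.single c 1) = Q.syzygy K c := by
  simp [syzygyMap]

lemma isGradedMap_generatorMap :
    IsGradedMap (fun k => ((u k).degree : ℤ)) 0 (generatorMap K u) := by
  intro k a
  rw [generatorMap_single]
  simpa using homogeneous_monomial (K := K) (u k) 1

lemma isGradedMap_syzygyMap [DecidableEq (Σ k, Q.A k)] :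
    IsGradedMap (fun c : Σ k, Q.A k => ((u c.1).degree : ℤ) + 1) (fun k => ((u k).degree : ℤ))
      (Q.syzygyMap K) := by
  intro c a
  rw [syzygyMap_single]
  have h1 : IsHomogeneousOfIntDegree ((Pi.single c.1 (X (c.2 : σ)) : ι → MvPolynomial σ K) a)
      ((u c.1).degree + 1 - (u a).degree) := by
    rcases eq_or_ne a c.1 with rfl | h
    · have := homogeneous_monomial (K := K) (Finsupp.single (c.2 : σ) 1) 1
      simpa [X] using this
    · rw [Pi.single_eq_of_ne h]
      exact homogeneous_zero _
  have h2 : IsHomogeneousOfIntDegree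
      ((Pi.single (Q.target c) (monomial (Q.cofactor c) 1) : ι → MvPolynomial σ K) a)
      ((u c.1).degree + 1 - (u a).degree) := by
    rcases eq_or_ne a (Q.target c) with rfl | h
    · have h3 := congrArg Finsupp.degree (Q.cofactor_add c)
      rw [map_add, map_add, Finsupp.degree_single] at h3
      rw [Pi.single_eq_same]
      convert homogeneous_monomial (K := K) (Q.cofactor c) 1 using 1
      omega
    · rw [Pi.single_eq_of_ne h]
      exact homogeneous_zero _
  rw [syzygy, Pi.sub_apply, ← intComponent_eq_self h1, ← intComponent_eq_self h2, ← map_sub]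
  exact intComponent_homogeneous _ _

lemma generatorMap_syzygy (c : Σ k, Q.A k) : generatorMap K u (Q.syzygy K c) = 0 := by
  funext _
  rw [syzygy, map_sub, Pi.sub_apply, generatorMap_apply, generatorMap_apply]
  simp [Pi.single_apply, ite_mul, X, monomial_mul, Q.cofactor_add, add_comm]

lemma constantCoeff_syzygyMap (g : (Σ k, Q.A k) → MvPolynomial σ K) (a : ι) :
    constantCoeff (Q.syzygyMap K g a) = 0 := by
  simp [syzygyMap, Fintype.linearCombination_apply, constantCoeff_syzygy]

lemma exists_mem_range_syzygyMap {k : ι} {p : MvPolynomial σ K}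
    (hp : p ∈ Ideal.span (X '' (Q.A k : Set σ))) :
    ∃ w ∈ LinearMap.range (Q.syzygyMap K), w k = p ∧
      ∀ j, j ≠ k → Q.pos k ≤ Q.pos j → w j = 0 := by
  classical
  induction hp using Submodule.span_induction with
  | mem x hx =>
    obtain ⟨z, hz, rfl⟩ := hx
    have hne : ∀ j, Q.pos k ≤ Q.pos j → j ≠ Q.target ⟨k, z, hz⟩ := by
      rintro j hj rfl
      exact absurd (Q.pos_target_lt ⟨k, z, hz⟩) (not_lt.2 hj)
    refine ⟨_, ⟨Pi.single ⟨k, z, hz⟩ 1, Q.syzygyMap_single _⟩, ?_, fun j hj hjk => ?_⟩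
    · rw [syzygy, Pi.sub_apply, Pi.single_eq_of_ne (hne k le_rfl), Pi.single_eq_same, sub_zero]
    · rw [syzygy, Pi.sub_apply, Pi.single_eq_of_ne (hne j hjk), Pi.single_eq_of_ne hj, sub_zero]
  | zero => exact ⟨0, Submodule.zero_mem _, rfl, fun _ _ _ => rfl⟩
  | add x y _ _ hx hy =>
    obtain ⟨w, hw, h1, h2⟩ := hx
    obtain ⟨w', hw', h1', h2'⟩ := hy
    exact ⟨w + w', Submodule.add_mem _ hw hw', by simp [h1, h1'],
      fun j hj hk => by simp [h2 j hj hk, h2' j hj hk]⟩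
  | smul a x _ hx =>
    obtain ⟨w, hw, h1, h2⟩ := hx
    exact ⟨a • w, Submodule.smul_mem _ a hw, by simp [h1], fun j hj hk => by simp [h2 j hj hk]⟩

/-- The leading coefficient of a syzygy, with respect to the order of the generators, lies in the
colon ideal. -/
lemma leading_coeff_mem {v : ι → MvPolynomial σ K} (hv : generatorMap K u v = 0) {k : ι}
    (hk : ∀ j, Q.pos k < Q.pos j → v j = 0) : v k ∈ Ideal.span (X '' (Q.A k : Set σ)) := by
  have h0 := congrFun hv ()
  rw [generatorMap_apply, ← Finset.add_sum_erase _ _ (Finset.mem_univ k), Pi.zero_apply] at h0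
  have h1 : v k * monomial (u k) 1 ∈
      Ideal.span ((fun m => monomial m (1 : K)) '' (u '' {j | Q.pos j < Q.pos k})) := by
    rw [eq_neg_of_add_eq_zero_left h0]
    refine neg_mem (Ideal.sum_mem _ fun j hj => ?_)
    by_cases hjk : Q.pos j < Q.pos k
    · exact Ideal.mul_mem_left _ _ (Ideal.subset_span ⟨u j, ⟨j, hjk, rfl⟩, rfl⟩)
    · have : Q.pos k < Q.pos j :=
        lt_of_le_of_ne (not_lt.1 hjk) fun h => (Finset.mem_erase.1 hj).1 (Q.pos_injective h).symm
      rw [hk j this, zero_mul]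
      exact zero_mem _
  rw [mem_ideal_span_monomial_image] at h1
  rw [mem_ideal_span_X_image]
  intro m hm
  obtain ⟨_, ⟨j, hj, rfl⟩, hle⟩ := h1 (m + u k) (by
    rw [mem_support_iff, coeff_mul_monomial, mul_one]
    exact mem_support_iff.1 hm)
  obtain ⟨z, hz, hlt⟩ := Q.exists_mem_lt j k hj
  refine ⟨z, hz, ?_⟩
  have := hle z
  rw [Finsupp.add_apply] at this
  omega

lemma mem_range_syzygyMap (v : ι → MvPolynomial σ K) :
    v ∈ LinearMap.range (Q.syzygyMap K) ↔ generatorMap K u v = 0 := by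
  have hle : ∀ w ∈ LinearMap.range (Q.syzygyMap K), generatorMap K u w = 0 := by
    rintro _ ⟨g, rfl⟩
    rw [syzygyMap, Fintype.linearCombination_apply, map_sum]
    exact Finset.sum_eq_zero fun c _ => by rw [map_smul, generatorMap_syzygy, smul_zero]
  refine ⟨hle v, fun hv => ?_⟩
  have main : ∀ (N : ℕ) (v : ι → MvPolynomial σ K), (∀ k, N ≤ Q.pos k → v k = 0) →
      generatorMap K u v = 0 → v ∈ LinearMap.range (Q.syzygyMap K) := by
    intro N
    induction N with
    | zero =>
      intro v hN _
      have : v = 0 := funext fun k => hN k (Nat.zero_le _)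
      rw [this]
      exact Submodule.zero_mem _
    | succ N ih =>
      intro v hN hv
      by_cases hk : ∃ k, Q.pos k = N
      · obtain ⟨k, rfl⟩ := hk
        obtain ⟨w, hw, h1, h2⟩ :=
          Q.exists_mem_range_syzygyMap (Q.leading_coeff_mem hv fun j hj => hN j hj)
        -- `w` cancels the leading coordinate of `v` and changes only earlier ones.
        rw [← sub_add_cancel v w]
        refine Submodule.add_mem _ (ih _ (fun j hj => ?_) ?_) hw
        · rcases eq_or_ne j k with rfl | hne
          · rw [Pi.sub_apply, h1, sub_self]
          · rw [Pi.sub_apply, h2 j hne hj, sub_zero]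
            exact hN j (lt_of_le_of_ne hj fun h => hne (Q.pos_injective h).symm)
        · rw [map_sub, hv, hle w hw, sub_zero]
      · refine ih v (fun k hNk => hN k ?_) hv
        exact lt_of_le_of_ne hNk fun h => hk ⟨k, h.symm⟩
  refine main (Finset.univ.sup Q.pos + 1) v (fun k hk => ?_) hv
  have := Finset.le_sup (f := Q.pos) (Finset.mem_univ k)
  omega

/-- The syzygies `z e_k - w e_j` are minimal generators: the linear part of the `k`-th coordinate of
a relation among them shows, by descending induction on the position of `k`, that the coefficients
have no constant term. -/
lemma constantCoeff_eq_zero_of_syzygyMap_eq_zero {g : (Σ k, Q.A k) → MvPolynomial σ K}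
    (hg : Q.syzygyMap K g = 0) (c : Σ k, Q.A k) : constantCoeff (g c) = 0 := by
  classical
  have main : ∀ (N : ℕ) (c : Σ k, Q.A k), Finset.univ.sup Q.pos - Q.pos c.1 = N →
      constantCoeff (g c) = 0 := by
    intro N
    induction N using Nat.strong_induction_on with
    | _ N ih =>
    intro c hc
    have h0 := congrFun hg c.1
    rw [syzygyMap, Fintype.linearCombination_apply, Finset.sum_apply, Pi.zero_apply] at h0
    have h1 := congrArg (coeff (Finsupp.single (c.2 : σ) 1)) h0
    rw [coeff_sum, coeff_zero, Finset.sum_eq_single c] at h1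
    · have hne : c.1 ≠ Q.target c := fun h => by
        have := Q.pos_target_lt c
        rw [← h] at this
        exact lt_irrefl _ this
      rw [Pi.smul_apply, syzygy, Pi.sub_apply, Pi.single_eq_same, Pi.single_eq_of_ne hne, sub_zero,
        smul_eq_mul, coeff_mul_X'] at h1
      simpa [constantCoeff_eq] using h1
    · rintro ⟨k, z⟩ - hne
      rw [Pi.smul_apply, smul_eq_mul]
      obtain ⟨k₀, z₀⟩ := c
      rcases eq_or_ne k k₀ with rfl | hk
      · have hne' : k ≠ Q.target ⟨k, z⟩ := fun h => by
          have := Q.pos_target_lt ⟨k, z⟩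
          rw [← h] at this
          exact lt_irrefl _ this
        have hz : z ≠ z₀ := fun h => hne (by rw [h])
        rw [syzygy, Pi.sub_apply, Pi.single_eq_same, Pi.single_eq_of_ne hne', sub_zero,
          coeff_mul_X', if_neg (by simpa using hz)]
      · by_cases ht : k₀ = Q.target ⟨k, z⟩
        -- Here `k` comes after `k₀`, so the induction hypothesis applies, and the cofactor is not `1`.
        · refine coeff_single_mul_eq_zero (ih _ ?_ ⟨k, z⟩ rfl) (constantCoeff_syzygy _ _ _) _
          have h2 := Q.pos_target_lt ⟨k, z⟩
          rw [← ht] at h2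
          have h3 := Finset.le_sup (f := Q.pos) (Finset.mem_univ k)
          simp only at h2 hc ⊢
          omega
        · rw [syzygy, Pi.sub_apply, Pi.single_eq_of_ne ht, Pi.single_eq_of_ne (Ne.symm hk), sub_zero,
            mul_zero, coeff_zero]
    · intro h
      exact absurd (Finset.mem_univ _) h
  exact main _ c rfl

/-- The first Betti numbers of an ideal with linear quotients. -/
theorem betti_eq (hu : ∀ k, u k ≠ 0) {J : Ideal (MvPolynomial σ K)}
    (hJ : J = Ideal.span ((fun m => monomial m (1 : K)) '' Set.range u))
    (S : MinimalGradedFreeResolution J) (j : ℤ) :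
    S.betti 1 j = (Finset.univ.filter fun k => ((u k).degree : ℤ) = j).card ∧
    S.betti 2 j = ∑ k, if ((u k).degree : ℤ) + 1 = j then (Q.A k).card else 0 := by
  classical
  have h := betti_eq_of_minimal_presentation (J := J)
    (fun p hp e => by rw [hJ] at hp ⊢; exact intComponent_mem_span_monomial hp e)
    (fun p hp => constantCoeff_eq_zero_of_mem_span_monomial hu (hJ ▸ hp))
    isGradedMap_generatorMap Q.isGradedMap_syzygyMap
    (fun v => by rw [hJ]; exact mem_range_generatorMap v) Q.mem_range_syzygyMap
    (fun v hv a => by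
      obtain ⟨g, rfl⟩ := (Q.mem_range_syzygyMap v).2 hv
      exact Q.constantCoeff_syzygyMap g a)
    (fun g hg => Q.constantCoeff_eq_zero_of_syzygyMap_eq_zero hg) S j
  refine ⟨h.1, h.2.trans ?_⟩
  rw [Finset.card_filter, Fintype.sum_sigma]
  refine Finset.sum_congr rfl fun k _ => ?_
  split_ifs <;> simp

end LinearQuotients

end LinearQuotients

end GradedFree

/-! ### Normal forms of monomials in the lattice with two chains -/

namespace CrystalLattice

section RevLex

variable {k : ℕ} {n : Fin k → ℕ}

lemma varLT_trichotomous (a b : CrystalLattice n) : varLT a b ∨ a = b ∨ varLT b a := by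
  cases a with
  | s => cases b <;> simp [varLT]
  | t => cases b <;> simp [varLT]
  | x i r =>
    cases b with
    | s => simp [varLT]
    | t => simp [varLT]
    | x j q =>
      rcases lt_trichotomy i j with h | rfl | h
      · exact Or.inl (Or.inl h)
      · rcases lt_trichotomy r.val q.val with h | h | h
        · exact Or.inl (Or.inr ⟨rfl, h⟩)
        · exact Or.inr (Or.inl (by rw [Fin.ext h]))
        · exact Or.inr (Or.inr (Or.inr ⟨rfl, h⟩))
      · exact Or.inr (Or.inr (Or.inl h))

lemma not_revLexLT_of_revLexLT {u v : CrystalLattice n →₀ ℕ} (h : RevLexLT varLT u v) :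
    ¬ RevLexLT varLT v u := by
  rintro (h' | ⟨h', b, hb, hb'⟩) <;> rcases h with h | ⟨h, a, ha, ha'⟩
  · omega
  · omega
  · omega
  · rcases varLT_trichotomous a b with hab | rfl | hab
    · exact ha.ne (hb' a hab)
    · exact lt_asymm ha hb
    · exact hb.ne (ha' b hab)

lemma revLexLT_irrefl (u : CrystalLattice n →₀ ℕ) : ¬ RevLexLT varLT u u := fun h =>
  not_revLexLT_of_revLexLT h h

instance : Finite (CrystalLattice n) := by
  refine Finite.of_injective (β := Option (Option (Σ i, Fin (n i))))
    (fun a => match a with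
      | s => none
      | t => some none
      | x i r => some (some ⟨i, r⟩)) fun a b h => ?_
  cases a <;> cases b <;> simp_all

end RevLex

section TwoChains

variable {n : ℕ}

/-- The element `x_{i+1}` of the first chain of `L_2(n, 2)`. -/
def xv (i : Fin n) : CrystalLattice ![n, 2] := .x 0 i

/-- The element `y_{j+1}` of the second chain of `L_2(n, 2)`. -/
def yv (j : Fin 2) : CrystalLattice ![n, 2] := .x 1 j

lemma cases_two_chains (a : CrystalLattice ![n, 2]) :
    a = s ∨ (∃ i, a = xv i) ∨ (∃ j, a = yv j) ∨ a = t := by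
  cases a with
  | s => exact Or.inl rfl
  | t => exact Or.inr (Or.inr (Or.inr rfl))
  | x i r =>
    revert r
    refine Fin.cases ?_ (fun i => ?_) i
    · exact fun r => Or.inr (Or.inl ⟨r, rfl⟩)
    · rw [Subsingleton.elim i 0]
      exact fun r => Or.inr (Or.inr (Or.inl ⟨r, rfl⟩))

@[simp] lemma xv_inj {i j : Fin n} : xv i = xv j ↔ i = j :=
  ⟨fun h => eq_of_heq (x.inj h).2, fun h => h ▸ rfl⟩
@[simp] lemma yv_inj {i j : Fin 2} : (yv i : CrystalLattice ![n, 2]) = yv j ↔ i = j :=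
  ⟨fun h => eq_of_heq (x.inj h).2, fun h => h ▸ rfl⟩
@[simp] lemma xv_ne_yv (i : Fin n) (j : Fin 2) : xv i ≠ yv j :=
  fun h => absurd (x.inj h).1 (by decide)
@[simp] lemma yv_ne_xv (i : Fin n) (j : Fin 2) : yv j ≠ xv i :=
  fun h => absurd (x.inj h).1 (by decide)
@[simp] lemma xv_ne_s (i : Fin n) : xv i ≠ s := by simp [xv]
@[simp] lemma xv_ne_t (i : Fin n) : xv i ≠ t := by simp [xv]
@[simp] lemma yv_ne_s (j : Fin 2) : (yv j : CrystalLattice ![n, 2]) ≠ s := by simp [yv]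
@[simp] lemma yv_ne_t (j : Fin 2) : (yv j : CrystalLattice ![n, 2]) ≠ t := by simp [yv]

@[simp] lemma not_varLT_s (a : CrystalLattice ![n, 2]) : ¬ varLT a s := by
  cases a <;> simp [varLT]

@[simp] lemma varLT_xv_xv {i j : Fin n} : varLT (xv i) (xv j) ↔ i < j := by
  simp [varLT, xv]

@[simp] lemma varLT_yv_yv {i j : Fin 2} :
    varLT (yv i : CrystalLattice ![n, 2]) (yv j) ↔ i < j := by
  simp [varLT, yv]

@[simp] lemma not_varLT_yv_xv (i : Fin n) (j : Fin 2) : ¬ varLT (yv j) (xv i) := by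
  simp [varLT, xv, yv]

@[simp] lemma not_varLT_t_xv (i : Fin n) : ¬ varLT t (xv i) := by simp [varLT]

@[simp] lemma not_varLT_t_yv (j : Fin 2) : ¬ varLT (t : CrystalLattice ![n, 2]) (yv j) := by
  simp [varLT]

lemma xv_sup_yv (i : Fin n) (j : Fin 2) : xv i ⊔ yv j = t := by
  change CrystalLattice.sup _ _ = _
  simp [CrystalLattice.sup, xv, yv]

lemma xv_inf_yv (i : Fin n) (j : Fin 2) : xv i ⊓ yv j = s := by
  change CrystalLattice.inf _ _ = _
  simp [CrystalLattice.inf, xv, yv]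

lemma comparable_or_incomparable (a b : CrystalLattice ![n, 2]) :
    (a ≤ b ∨ b ≤ a) ∨ ∃ i j, (a = xv i ∧ b = yv j) ∨ (a = yv j ∧ b = xv i) := by
  have hs : ∀ c : CrystalLattice ![n, 2], s ≤ c := fun c => by
    change CrystalLattice.le _ _
    cases c <;> simp [CrystalLattice.le]
  have ht : ∀ c : CrystalLattice ![n, 2], c ≤ t := fun c => by
    change CrystalLattice.le _ _
    cases c <;> simp [CrystalLattice.le]
  have hx : ∀ i i' : Fin n, i ≤ i' → xv i ≤ xv i' := fun i i' h => ⟨rfl, h⟩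
  have hy : ∀ j j' : Fin 2, j ≤ j' → (yv j : CrystalLattice ![n, 2]) ≤ yv j' :=
    fun j j' h => ⟨rfl, h⟩
  rcases cases_two_chains a with rfl | ⟨i, rfl⟩ | ⟨j, rfl⟩ | rfl
  · exact Or.inl (Or.inl (hs b))
  · rcases cases_two_chains b with rfl | ⟨i', rfl⟩ | ⟨j', rfl⟩ | rfl
    · exact Or.inl (Or.inr (hs _))
    · exact Or.inl ((le_total i i').imp (hx _ _) (hx _ _))
    · exact Or.inr ⟨i, j', Or.inl ⟨rfl, rfl⟩⟩
    · exact Or.inl (Or.inl (ht _))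
  · rcases cases_two_chains b with rfl | ⟨i', rfl⟩ | ⟨j', rfl⟩ | rfl
    · exact Or.inl (Or.inr (hs _))
    · exact Or.inr ⟨i', j, Or.inr ⟨rfl, rfl⟩⟩
    · exact Or.inl ((le_total j j').imp (hy _ _) (hy _ _))
    · exact Or.inl (Or.inl (ht _))
  · exact Or.inl (Or.inr (ht b))

/-- The total exponent of the variables of the first chain. -/
def xDegree (m : CrystalLattice ![n, 2] →₀ ℕ) : ℕ := ∑ i, m (xv i)

/-- The total exponent of the variables of the second chain. -/
def yDegree (m : CrystalLattice ![n, 2] →₀ ℕ) : ℕ := ∑ j, m (yv j)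

lemma xDegree_add (m m' : CrystalLattice ![n, 2] →₀ ℕ) :
    xDegree (m + m') = xDegree m + xDegree m' := by
  simp [xDegree, Finset.sum_add_distrib]

lemma yDegree_add (m m' : CrystalLattice ![n, 2] →₀ ℕ) :
    yDegree (m + m') = yDegree m + yDegree m' := by
  simp only [yDegree, Finsupp.add_apply, Finset.sum_add_distrib]

@[simp] lemma xDegree_single_xv (i : Fin n) (c : ℕ) : xDegree (Finsupp.single (xv i) c) = c := by
  classical simp [xDegree, Finsupp.single_apply]

@[simp] lemma xDegree_single_yv (j : Fin 2) (c : ℕ) :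
    xDegree (Finsupp.single (yv j : CrystalLattice ![n, 2]) c) = 0 := by
  simp [xDegree]

@[simp] lemma xDegree_single_s (c : ℕ) :
    xDegree (Finsupp.single (s : CrystalLattice ![n, 2]) c) = 0 := by
  simp [xDegree]

@[simp] lemma xDegree_single_t (c : ℕ) :
    xDegree (Finsupp.single (t : CrystalLattice ![n, 2]) c) = 0 := by
  simp [xDegree]

@[simp] lemma yDegree_single_xv (i : Fin n) (c : ℕ) : yDegree (Finsupp.single (xv i) c) = 0 := by
  simp [yDegree]

@[simp] lemma yDegree_single_yv (j : Fin 2) (c : ℕ) :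
    yDegree (Finsupp.single (yv j : CrystalLattice ![n, 2]) c) = c := by
  classical
  simp only [yDegree, Finsupp.single_apply, yv_inj, Finset.sum_ite_eq, Finset.mem_univ, if_true]

@[simp] lemma yDegree_single_s (c : ℕ) :
    yDegree (Finsupp.single (s : CrystalLattice ![n, 2]) c) = 0 := by
  simp [yDegree]

@[simp] lemma yDegree_single_t (c : ℕ) :
    yDegree (Finsupp.single (t : CrystalLattice ![n, 2]) c) = 0 := by
  simp [yDegree]

lemma degree_eq (m : CrystalLattice ![n, 2] →₀ ℕ) :
    m.degree = m s + xDegree m + yDegree m + m t := by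
  classical
  induction m using Finsupp.induction_linear with
  | zero => simp [xDegree, yDegree]
  | add f g hf hg =>
    rw [map_add, hf, hg, xDegree_add, yDegree_add, Finsupp.add_apply, Finsupp.add_apply]
    ring
  | single a c =>
    rcases cases_two_chains a with rfl | ⟨i, rfl⟩ | ⟨j, rfl⟩ | rfl <;>
      simp

lemma le_xDegree (m : CrystalLattice ![n, 2] →₀ ℕ) (i : Fin n) : m (xv i) ≤ xDegree m :=
  Finset.single_le_sum (f := fun i => m (xv i)) (fun _ _ => Nat.zero_le _) (Finset.mem_univ i)

lemma eq_zero_of_eq_xDegree {m : CrystalLattice ![n, 2] →₀ ℕ} {i j : Fin n}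
    (h : m (xv i) = xDegree m) (hj : j ≠ i) : m (xv j) = 0 := by
  rw [xDegree, ← Finset.add_sum_erase _ _ (Finset.mem_univ i)] at h
  have h0 : ∑ l ∈ Finset.univ.erase i, m (xv l) = 0 := by omega
  exact Finset.sum_eq_zero_iff.1 h0 j (Finset.mem_erase.2 ⟨hj, Finset.mem_univ j⟩)

lemma yDegree_eq (m : CrystalLattice ![n, 2] →₀ ℕ) : yDegree m = m (yv 0) + m (yv 1) :=
  Fin.sum_univ_two _

/-- The number of pairs `x_i y_j` that can be split off a monomial. -/
def pairs (m : CrystalLattice ![n, 2] →₀ ℕ) : ℕ := min (xDegree m) (yDegree m)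

variable [NeZero n]

open Classical in
/-- The normal form of a monomial modulo the join-meet ideal: `x_i y_j` is replaced by `s t` as long
as possible, and if `s t` divides the result, then every remaining `x_i` is replaced by `x_1` and
every remaining `y_j` by `y_1`. -/
noncomputable def normalForm (m : CrystalLattice ![n, 2] →₀ ℕ) : CrystalLattice ![n, 2] →₀ ℕ :=
  if pairs m = 0 ∧ (m s = 0 ∨ m t = 0) then m else
    Finsupp.single s (m s + pairs m) + Finsupp.single t (m t + pairs m) +
      Finsupp.single (xv 0) (xDegree m - pairs m) + Finsupp.single (yv 0) (yDegree m - pairs m)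

lemma normalForm_add_pair (m : CrystalLattice ![n, 2] →₀ ℕ) (i : Fin n) (j : Fin 2) :
    normalForm (m + (Finsupp.single (xv i) 1 + Finsupp.single (yv j) 1)) =
      normalForm (m + (Finsupp.single s 1 + Finsupp.single t 1)) := by
  classical
  have h1 : pairs (m + (Finsupp.single (xv i) 1 + Finsupp.single (yv j) 1)) = pairs m + 1 := by
    simp [pairs, xDegree_add, yDegree_add]
  have h2 : pairs (m + (Finsupp.single s 1 + Finsupp.single t 1)) = pairs m := by
    simp [pairs, xDegree_add, yDegree_add]
  rw [normalForm, normalForm, h1, h2,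
    if_neg (fun h => absurd h.1 (Nat.succ_ne_zero _)), if_neg (by simp)]
  simp [xDegree_add, yDegree_add, add_assoc, add_comm 1]

/-- Normal forms do not increase: either the exponent of the smallest variable `s` grows, or it stays
and variables of one chain are traded for the smallest one of that chain. -/
lemma normalForm_eq_or_revLexLT (m : CrystalLattice ![n, 2] →₀ ℕ) :
    normalForm m = m ∨ RevLexLT varLT (normalForm m) m := by
  classical
  by_cases h : pairs m = 0 ∧ (m s = 0 ∨ m t = 0)
  · exact Or.inl (by rw [normalForm, if_pos h])
  have hx : pairs m ≤ xDegree m := min_le_left _ _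
  have hy : pairs m ≤ yDegree m := min_le_right _ _
  have hs : normalForm m s = m s + pairs m := by
    rw [normalForm, if_neg h]; simp
  have ht : normalForm m t = m t + pairs m := by
    rw [normalForm, if_neg h]; simp
  have hx0 : normalForm m (xv 0) = xDegree m - pairs m := by
    rw [normalForm, if_neg h]; simp
  have hxi : ∀ i, i ≠ 0 → normalForm m (xv i) = 0 := fun i hi => by
    rw [normalForm, if_neg h]; simp [hi.symm]
  have hy0 : normalForm m (yv 0) = yDegree m - pairs m := by
    rw [normalForm, if_neg h]; simp
  have hy1 : normalForm m (yv 1) = 0 := by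
    rw [normalForm, if_neg h]; simp
  have hdeg : (normalForm m).degree = m.degree := by
    rw [degree_eq m, normalForm, if_neg h]
    simp only [map_add, Finsupp.degree_single]
    omega
  by_cases hp : pairs m = 0
  · rw [hp] at hs ht hx0 hy0
    by_cases h1 : m (xv 0) = xDegree m
    · by_cases h2 : m (yv 0) = yDegree m
      · left
        ext a
        rcases cases_two_chains a with rfl | ⟨i, rfl⟩ | ⟨j, rfl⟩ | rfl
        · exact hs
        · rcases eq_or_ne i 0 with rfl | hi
          · rw [hx0, h1, Nat.sub_zero]
          · rw [hxi i hi, eq_zero_of_eq_xDegree h1 hi]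
        · rw [yDegree_eq] at h2 hy0
          fin_cases j
          · change normalForm m (yv 0) = m (yv 0)
            omega
          · change normalForm m (yv 1) = m (yv 1)
            omega
        · exact ht
      · refine Or.inr (Or.inr ⟨hdeg, yv 0, ?_, fun b hb => ?_⟩)
        · rw [yDegree_eq] at h2 hy0
          omega
        · rcases cases_two_chains b with rfl | ⟨i, rfl⟩ | ⟨j, rfl⟩ | rfl
          · exact hs
          · rcases eq_or_ne i 0 with rfl | hi
            · rw [hx0, h1, Nat.sub_zero]
            · rw [hxi i hi, eq_zero_of_eq_xDegree h1 hi]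
          · exact absurd (varLT_yv_yv.1 hb) (Fin.not_lt_zero j)
          · exact absurd hb (not_varLT_t_yv _)
    · refine Or.inr (Or.inr ⟨hdeg, xv 0, ?_, fun b hb => ?_⟩)
      · have := le_xDegree m 0
        omega
      · rcases cases_two_chains b with rfl | ⟨i, rfl⟩ | ⟨j, rfl⟩ | rfl
        · exact hs
        · exact absurd (varLT_xv_xv.1 hb) (not_lt.2 (Fin.zero_le i))
        · exact absurd hb (not_varLT_yv_xv _ _)
        · exact absurd hb (not_varLT_t_xv _)
  · exact Or.inr (Or.inr ⟨hdeg, s, by omega, fun b hb => absurd hb (not_varLT_s b)⟩)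

end TwoChains

end CrystalLattice

/-! ### The initial ideal of the join-meet ideal -/

namespace CrystalLattice

section InitialIdeal

variable {n : ℕ} {K : Type*} [Field K]

lemma isInitialMonomial_binomial {u v : CrystalLattice ![n, 2] →₀ ℕ}
    (h : RevLexLT varLT v u) :
    IsInitialMonomial varLT (monomial u (1 : K) - monomial v 1) u := by
  classical
  have hne : v ≠ u := fun h' => revLexLT_irrefl u (h' ▸ h)
  constructor
  · rw [mem_support_iff, coeff_sub, coeff_monomial, coeff_monomial, if_pos rfl, if_neg hne, sub_zero]
    exact one_ne_zero
  · intro w hw hwu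
    rw [mem_support_iff, coeff_sub, coeff_monomial, coeff_monomial, if_neg hwu.symm] at hw
    have : v = w := by by_contra h'; simp [h'] at hw
    exact this ▸ h

lemma pair_sub_mem (i : Fin n) (j : Fin 2) :
    X (xv i) * X (yv j) - X t * X s ∈ joinMeetIdeal K (CrystalLattice ![n, 2]) :=
  Ideal.subset_span ⟨xv i, yv j, by rw [xv_sup_yv, xv_inf_yv]⟩

variable [NeZero n]

/-- The exponents of the generators of the initial ideal: `x_i y_j`, indexed by `(j, i)`, and the
cubics `s t y_2` (indexed by `0`) and `s t x_{k+1}` (indexed by `k ≠ 0`). -/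
noncomputable def genExp : (Fin 2 × Fin n) ⊕ Fin n → CrystalLattice ![n, 2] →₀ ℕ
  | .inl c => Finsupp.single (xv c.2) 1 + Finsupp.single (yv c.1) 1
  | .inr k => Finsupp.single s 1 + Finsupp.single t 1 +
      Finsupp.single (if k = 0 then yv 1 else xv k) 1

/-- A monomial divisible by no generator is its own normal form. -/
lemma normalForm_eq_self {m : CrystalLattice ![n, 2] →₀ ℕ} (hm : ∀ c, ¬ genExp c ≤ m) :
    normalForm m = m := by
  classical
  have hp : pairs m = 0 := by
    by_contra hp
    have hx : xDegree m ≠ 0 := fun h => hp (by simp [pairs, h])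
    have hy : yDegree m ≠ 0 := fun h => hp (by simp [pairs, h])
    obtain ⟨i, -, hi⟩ := Finset.exists_ne_zero_of_sum_ne_zero hx
    obtain ⟨j, -, hj⟩ := Finset.exists_ne_zero_of_sum_ne_zero hy
    refine hm (.inl (j, i)) fun a => ?_
    rcases cases_two_chains a with rfl | ⟨i', rfl⟩ | ⟨j', rfl⟩ | rfl
    · simp [genExp]
    · by_cases h : i = i'
      · subst h
        simpa [genExp] using Nat.one_le_iff_ne_zero.2 hi
      · simp [genExp, h]
    · by_cases h : j = j'
      · subst h
        simpa [genExp] using Nat.one_le_iff_ne_zero.2 hj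
      · simp [genExp, h]
    · simp [genExp]
  by_cases hst : m s = 0 ∨ m t = 0
  · rw [normalForm, if_pos ⟨hp, hst⟩]
  rw [not_or] at hst
  have hcub : ∀ k : Fin n, m (if k = 0 then yv 1 else xv k) = 0 := by
    intro k
    by_contra h
    refine hm (.inr k) fun a => ?_
    have h1 : (if k = 0 then yv 1 else xv k : CrystalLattice ![n, 2]) ≠ s := by
      split_ifs <;> simp
    have h2 : (if k = 0 then yv 1 else xv k : CrystalLattice ![n, 2]) ≠ t := by
      split_ifs <;> simp
    revert h h1 h2
    rw [genExp]
    generalize (if k = 0 then yv 1 else xv k : CrystalLattice ![n, 2]) = b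
    intro h h1 h2
    rcases eq_or_ne b a with rfl | hb
    · simpa [h1, h2] using Nat.one_le_iff_ne_zero.2 h
    rcases eq_or_ne a s with rfl | ha
    · simpa [hb] using Nat.one_le_iff_ne_zero.2 hst.1
    rcases eq_or_ne a t with rfl | ha'
    · simpa [hb] using Nat.one_le_iff_ne_zero.2 hst.2
    simp [hb, ha.symm, ha'.symm]
  have hxi : ∀ i : Fin n, i ≠ 0 → m (xv i) = 0 := fun i hi => by simpa [hi] using hcub i
  have hy1 : m (yv 1) = 0 := by simpa using hcub 0
  have hx : xDegree m = m (xv 0) := by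
    rw [xDegree, Finset.sum_eq_single (0 : Fin n)]
    · exact fun i _ hi => hxi i hi
    · exact fun h => absurd (Finset.mem_univ _) h
  have hy : yDegree m = m (yv 0) := by rw [yDegree_eq, hy1, add_zero]
  rw [normalForm, if_neg (by tauto), hp, hx, hy]
  ext a
  rcases cases_two_chains a with rfl | ⟨i, rfl⟩ | ⟨j, rfl⟩ | rfl
  · simp
  · rcases eq_or_ne i 0 with rfl | hi
    · simp
    · simp [hi.symm, hxi i hi]
  · fin_cases j
    · simp
    · simpa using hy1.symm
  · simp

variable (K) in
/-- The `K`-linear map sending each monomial to its normal form. -/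
noncomputable def normalFormMap :
    MvPolynomial (CrystalLattice ![n, 2]) K →ₗ[K] MvPolynomial (CrystalLattice ![n, 2]) K :=
  (basisMonomials (CrystalLattice ![n, 2]) K).constr K fun m => monomial (normalForm m) (1 : K)

lemma normalFormMap_monomial (m : CrystalLattice ![n, 2] →₀ ℕ) (c : K) :
    normalFormMap K (monomial m c) = monomial (normalForm m) c := by
  have h := (basisMonomials (CrystalLattice ![n, 2]) K).constr_basis K
    (fun m => monomial (normalForm m) (1 : K)) m
  rw [coe_basisMonomials] at h
  have h1 : (monomial m c : MvPolynomial (CrystalLattice ![n, 2]) K) = c • monomial m 1 := by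
    rw [smul_monomial, smul_eq_mul, mul_one]
  rw [h1, map_smul]
  change c • ((basisMonomials (CrystalLattice ![n, 2]) K).constr K
    (fun m => monomial (normalForm m) (1 : K))) (monomial m 1) = _
  rw [h, smul_monomial, smul_eq_mul, mul_one]

lemma normalFormMap_eq_zero {f : MvPolynomial (CrystalLattice ![n, 2]) K}
    (hf : f ∈ joinMeetIdeal K (CrystalLattice ![n, 2])) : normalFormMap K f = 0 := by
  have hgen : ∀ (p : MvPolynomial (CrystalLattice ![n, 2]) K) (i : Fin n) (j : Fin 2),
      normalFormMap K (p * (X (xv i) * X (yv j) - X t * X s)) = 0 := by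
    intro p i j
    induction p using MvPolynomial.induction_on' with
    | monomial m c =>
      have h1 : monomial m c * (X (xv i) * X (yv j) : MvPolynomial (CrystalLattice ![n, 2]) K) =
          monomial (m + (Finsupp.single (xv i) 1 + Finsupp.single (yv j) 1)) c := by
        simp [X, monomial_mul]
      have h2 : monomial m c * (X t * X s : MvPolynomial (CrystalLattice ![n, 2]) K) =
          monomial (m + (Finsupp.single s 1 + Finsupp.single t 1)) c := by
        rw [mul_comm (X t)]
        simp [X, monomial_mul]
      rw [mul_sub, h1, h2, map_sub, normalFormMap_monomial, normalFormMap_monomial,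
        normalForm_add_pair, sub_self]
    | add p q hp hq => rw [add_mul, map_add, hp, hq, add_zero]
  have main : ∀ p, normalFormMap K (p * f) = 0 := by
    induction hf using Submodule.span_induction with
    | mem g hg =>
      obtain ⟨a, b, rfl⟩ := hg
      intro p
      rcases comparable_or_incomparable a b with (h | h) | ⟨i, j, ⟨rfl, rfl⟩ | ⟨rfl, rfl⟩⟩
      · rw [sup_eq_right.2 h, inf_eq_left.2 h, mul_comm (X b), sub_self, mul_zero, map_zero]
      · rw [sup_eq_left.2 h, inf_eq_right.2 h, sub_self, mul_zero, map_zero]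
      · rw [xv_sup_yv, xv_inf_yv]
        exact hgen p i j
      · rw [sup_comm, inf_comm, xv_sup_yv, xv_inf_yv, mul_comm (X (yv j))]
        exact hgen p i j
    | zero => intro p; rw [mul_zero, map_zero]
    | add x y _ _ hx hy => intro p; rw [mul_add, map_add, hx, hy, add_zero]
    | smul a x _ hx => intro p; rw [smul_eq_mul, ← mul_assoc, hx]
  simpa using main 1

/-- For each generator `u` there is a smaller monomial `v` with `u - v` in the join-meet ideal:
`x_i y_j - s t`, `s t y_2 - s t y_1` and `s t x_k - s t x_1`. -/
lemma exists_binomial_mem (c : (Fin 2 × Fin n) ⊕ Fin n) :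
    ∃ v, RevLexLT varLT v (genExp c) ∧
      monomial (genExp c) (1 : K) - monomial v 1 ∈ joinMeetIdeal K (CrystalLattice ![n, 2]) := by
  have hcub : ∀ b : CrystalLattice ![n, 2],
      (monomial (Finsupp.single s 1 + Finsupp.single t 1 + Finsupp.single b 1) (1 : K)) =
        X s * X t * X b := fun b => by simp [X, monomial_mul]
  rcases c with ⟨j, i⟩ | k
  · refine ⟨Finsupp.single t 1 + Finsupp.single s 1, Or.inr ⟨?_, s, ?_, ?_⟩, ?_⟩
    · simp [genExp]
    · simp [genExp]
    · exact fun b hb => absurd hb (not_varLT_s b)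
    · have := pair_sub_mem (K := K) i j
      simpa [genExp, X, monomial_mul] using this
  · by_cases hk : k = 0
    · refine ⟨Finsupp.single s 1 + Finsupp.single t 1 + Finsupp.single (yv 0) 1,
        Or.inr ⟨?_, yv 0, ?_, ?_⟩, ?_⟩
      · simp [genExp]
      · simp [genExp, hk]
      · intro b hb
        have h0 : (yv 0 : CrystalLattice ![n, 2]) ≠ b := fun h => by
          rw [← h, varLT_yv_yv] at hb; exact lt_irrefl _ hb
        have h1 : (yv 1 : CrystalLattice ![n, 2]) ≠ b := fun h => by
          rw [← h, varLT_yv_yv] at hb; exact absurd hb (by decide)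
        simp [genExp, hk, h0, h1]
      · rw [genExp, if_pos hk, hcub, hcub]
        have h := sub_mem
          (Ideal.mul_mem_left _ (X (yv 1)) (pair_sub_mem (K := K) (0 : Fin n) 0))
          (Ideal.mul_mem_left _ (X (yv 0)) (pair_sub_mem (K := K) (0 : Fin n) 1))
        convert neg_mem h using 1
        ring
    · refine ⟨Finsupp.single s 1 + Finsupp.single t 1 + Finsupp.single (xv 0) 1,
        Or.inr ⟨?_, xv 0, ?_, ?_⟩, ?_⟩
      · simp [genExp]
      · simp [genExp, hk]
      · intro b hb
        have h0 : xv 0 ≠ b := fun h => by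
          rw [← h, varLT_xv_xv] at hb; exact lt_irrefl _ hb
        have h1 : xv k ≠ b := fun h => by
          rw [← h, varLT_xv_xv] at hb; exact absurd hb (not_lt.2 (Fin.zero_le k))
        simp [genExp, hk, h0, h1]
      · rw [genExp, if_neg hk, hcub, hcub]
        have h := sub_mem
          (Ideal.mul_mem_left _ (X (xv k)) (pair_sub_mem (K := K) (0 : Fin n) 0))
          (Ideal.mul_mem_left _ (X (xv 0)) (pair_sub_mem (K := K) k 0))
        convert neg_mem h using 1
        ring

/-- The binomials with initial monomials `x_i y_j`, `s t y_2`, `s t x_k` form a Gröbner basis of the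
join-meet ideal. If the initial monomial `u` of `f` in the ideal were divisible by no generator,
then `u` would be its own normal form while all other monomials of `f` have smaller normal forms,
so `u` would survive in the image of `f` under `normalFormMap`, which is zero. -/
theorem crystalInitialIdeal_eq :
    crystalInitialIdeal K ![n, 2] =
      Ideal.span ((fun m => monomial m (1 : K)) '' Set.range (genExp (n := n))) := by
  classical
  apply le_antisymm
  · refine Ideal.span_le.2 ?_
    rintro _ ⟨f, hf, u, ⟨hu, hlt⟩, rfl⟩
    rw [SetLike.mem_coe, mem_ideal_span_monomial_image]
    intro m hm
    have hmu : m = u := by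
      rw [mem_support_iff, coeff_monomial] at hm
      by_contra h
      simp [Ne.symm h] at hm
    subst hmu
    by_contra! hstd
    have h0 := congrArg (coeff m) (normalFormMap_eq_zero hf)
    rw [f.as_sum, map_sum, coeff_sum, coeff_zero, Finset.sum_eq_single m] at h0
    · rw [normalFormMap_monomial, normalForm_eq_self fun c => hstd _ ⟨c, rfl⟩, coeff_monomial,
        if_pos rfl] at h0
      exact mem_support_iff.1 hu h0
    · intro w hw hwm
      rw [normalFormMap_monomial, coeff_monomial, if_neg]
      intro h
      rcases normalForm_eq_or_revLexLT w with h' | h'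
      · exact hwm (h'.symm.trans h)
      · exact not_revLexLT_of_revLexLT (hlt w hw hwm) (h ▸ h')
    · exact fun h => absurd hu h
  · refine Ideal.span_le.2 ?_
    rintro _ ⟨_, ⟨c, rfl⟩, rfl⟩
    obtain ⟨v, hv, hmem⟩ := exists_binomial_mem (K := K) c
    exact Ideal.subset_span ⟨_, hmem, _, isInitialMonomial_binomial hv, rfl⟩

end InitialIdeal

end CrystalLattice

/-! ### Linear quotients and Betti numbers of the initial ideal -/

namespace CrystalLattice

section Betti

variable {n : ℕ}

lemma xv_injective : Function.Injective (xv (n := n)) := fun _ _ h => xv_inj.1 h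

/-- The position of a generator in the order `x_1 y_1, …, x_n y_1, x_1 y_2, …, x_n y_2, s t y_2,
s t x_2, …, s t x_n`. -/
def genPos : (Fin 2 × Fin n) ⊕ Fin n → ℕ
  | .inl c => c.1 * n + c.2
  | .inr k => 2 * n + k

lemma genPos_inl_lt (c : Fin 2 × Fin n) : genPos (.inl c) < 2 * n := by
  obtain ⟨j, i⟩ := c
  have := i.isLt
  fin_cases j <;> simp [genPos] <;> omega

lemma genPos_injective : Function.Injective (genPos (n := n)) := by
  rintro (⟨j, i⟩ | k) (⟨j', i'⟩ | k') h
  · have h1 := i.isLt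
    have h2 := i'.isLt
    fin_cases j <;> fin_cases j' <;> simp [genPos] at h ⊢ <;> omega
  · have := genPos_inl_lt (j, i)
    simp only [genPos] at h this
    omega
  · have := genPos_inl_lt (j', i')
    simp only [genPos] at h this
    omega
  · simp only [genPos] at h
    rw [Fin.ext (Nat.add_left_cancel h)]

variable [NeZero n]

open Classical in
/-- The variables generating the successive colon ideals of the generators, in the order given by
`genPos`. -/
noncomputable def colonVars : (Fin 2 × Fin n) ⊕ Fin n → Finset (CrystalLattice ![n, 2])
  | .inl c => (Finset.univ.filter (· < c.2)).image xv ∪ if c.1 = 0 then ∅ else {yv 0}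
  | .inr k => if k = 0 then Finset.univ.image xv else
      (Finset.univ.filter fun l => 0 < l ∧ l < k).image xv ∪ Finset.univ.image yv

lemma degree_genExp_inl (c : Fin 2 × Fin n) : (genExp (.inl c)).degree = 2 := by
  simp [genExp]

lemma degree_genExp_inr (k : Fin n) : (genExp (.inr k)).degree = 3 := by
  simp [genExp]

lemma genExp_ne_zero (c : (Fin 2 × Fin n) ⊕ Fin n) : genExp c ≠ 0 := by
  intro h
  have h' := congrArg Finsupp.degree h
  rcases c with c | k
  · rw [degree_genExp_inl, map_zero] at h'
    omega
  · rw [degree_genExp_inr, map_zero] at h'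
    omega

lemma degree_genExp_le {c c' : (Fin 2 × Fin n) ⊕ Fin n} (h : genPos c < genPos c') :
    (genExp c).degree ≤ (genExp c').degree := by
  rcases c with c | k <;> rcases c' with c' | k'
  · simp only [degree_genExp_inl, le_refl]
  · rw [degree_genExp_inl, degree_genExp_inr]; omega
  · have := genPos_inl_lt c'
    simp only [genPos] at h this
    omega
  · simp only [degree_genExp_inr, le_refl]

/-- Each variable `z` of the colon ideal of `u_k` multiplies `u_k` into an earlier `u_j`. -/
lemma exists_target (c : (Fin 2 × Fin n) ⊕ Fin n) {z : CrystalLattice ![n, 2]}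
    (hz : z ∈ colonVars c) :
    ∃ c', genPos c' < genPos c ∧ genExp c' ≤ genExp c + Finsupp.single z 1 := by
  classical
  rcases c with ⟨j, i⟩ | k
  · rw [colonVars, Finset.mem_union] at hz
    rcases hz with hz | hz
    · obtain ⟨l, hl, rfl⟩ := Finset.mem_image.1 hz
      refine ⟨.inl (j, l), ?_, ?_⟩
      · have : l < i := (Finset.mem_filter.1 hl).2
        simpa [genPos] using this
      · refine le_iff_exists_add.2 ⟨Finsupp.single (xv i) 1, ?_⟩
        simp only [genExp]
        abel
    · by_cases hj : j = 0
      · simp [hj] at hz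
      · have hj1 : j = 1 := by omega
        subst hj1
        simp only [hj, if_false, Finset.mem_singleton] at hz
        subst hz
        refine ⟨.inl (0, i), ?_, ?_⟩
        · have := Nat.pos_of_ne_zero (NeZero.ne n)
          simpa [genPos] using this
        · refine le_iff_exists_add.2 ⟨Finsupp.single (yv 1) 1, ?_⟩
          simp only [genExp]
          abel
  · by_cases hk : k = 0
    · simp only [colonVars, hk, if_true] at hz
      obtain ⟨l, -, rfl⟩ := Finset.mem_image.1 hz
      refine ⟨.inl (1, l), lt_of_lt_of_le (genPos_inl_lt _) (Nat.le_add_right _ _), ?_⟩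
      refine le_iff_exists_add.2 ⟨Finsupp.single s 1 + Finsupp.single t 1, ?_⟩
      simp only [genExp, hk, if_true]
      abel
    · simp only [colonVars, hk, if_false, Finset.mem_union] at hz
      rcases hz with hz | hz
      · obtain ⟨l, hl, rfl⟩ := Finset.mem_image.1 hz
        obtain ⟨-, hl0, hlk⟩ := Finset.mem_filter.1 hl
        refine ⟨.inr l, by simpa [genPos] using hlk, ?_⟩
        refine le_iff_exists_add.2 ⟨Finsupp.single (xv k) 1, ?_⟩
        simp only [genExp, hk, hl0.ne', if_false]
        abel
      · obtain ⟨j, -, rfl⟩ := Finset.mem_image.1 hz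
        refine ⟨.inl (j, k), lt_of_lt_of_le (genPos_inl_lt _) (Nat.le_add_right _ _), ?_⟩
        refine le_iff_exists_add.2 ⟨Finsupp.single s 1 + Finsupp.single t 1, ?_⟩
        simp only [genExp, hk, if_false]
        abel

/-- Each quotient `u_j : u_k` with `j` before `k` is divisible by a variable of the colon ideal. -/
lemma exists_mem_colonVars_lt (c' c : (Fin 2 × Fin n) ⊕ Fin n) (h : genPos c' < genPos c) :
    ∃ z ∈ colonVars c, genExp c z < genExp c' z := by
  classical
  rcases c with ⟨j, i⟩ | k
  · rcases c' with ⟨j', i'⟩ | k'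
    · by_cases hj : j' = j
      · subst hj
        have hi : i' < i := by simpa [genPos] using h
        exact ⟨xv i', by simp [colonVars, hi], by simp [genExp, hi.ne']⟩
      · have hlt := i.isLt
        have hlt' := i'.isLt
        have hjj : j' = 0 ∧ j = 1 := by
          fin_cases j <;> fin_cases j' <;> simp [genPos] at h hj ⊢
          omega
        obtain ⟨rfl, rfl⟩ := hjj
        exact ⟨yv 0, by simp [colonVars], by simp [genExp]⟩
    · have := genPos_inl_lt (j, i)
      simp only [genPos] at h this
      omega
  · by_cases hk : k = 0
    · rcases c' with ⟨j', i'⟩ | k'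
      · exact ⟨xv i', by simp [colonVars, hk], by simp [genExp, hk]⟩
      · simp [genPos, hk] at h
    · rcases c' with ⟨j', i'⟩ | k'
      · exact ⟨yv j', by simp [colonVars, hk], by simp [genExp, hk]⟩
      · have hkk : k' < k := by simpa [genPos] using h
        by_cases hk' : k' = 0
        · exact ⟨yv 1, by simp [colonVars, hk], by simp [genExp, hk, hk']⟩
        · refine ⟨xv k', ?_, by simp [genExp, hk, hk', hkk.ne']⟩
          simp [colonVars, hk, Fin.pos_iff_ne_zero.2 hk', hkk]

variable (n) in
/-- The generators of the initial ideal have linear quotients. -/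
noncomputable def linearQuotients : GradedFree.LinearQuotients (genExp (n := n)) where
  pos := genPos
  pos_injective := genPos_injective
  A := colonVars
  target c := (exists_target c.1 c.2.2).choose
  pos_target_lt c := (exists_target c.1 c.2.2).choose_spec.1
  target_le c := (exists_target c.1 c.2.2).choose_spec.2
  target_ne c h := by
    have h1 := congrArg Finsupp.degree h
    have h2 := degree_genExp_le (exists_target c.1 c.2.2).choose_spec.1
    rw [map_add, Finsupp.degree_single] at h1
    omega
  exists_mem_lt := exists_mem_colonVars_lt

lemma card_colonVars_inl (c : Fin 2 × Fin n) :
    (colonVars (.inl c)).card = c.2 + c.1 := by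
  classical
  obtain ⟨j, i⟩ := c
  have h1 : ((Finset.univ.filter (· < i)).image xv).card = i := by
    have : Finset.univ.filter (· < i) = Finset.Iio i := by ext; simp
    rw [Finset.card_image_of_injective _ xv_injective, this, Fin.card_Iio]
  simp only [colonVars]
  by_cases hj : j = 0
  · simp [hj, h1]
  · have hj1 : j = 1 := by omega
    subst hj1
    rw [if_neg hj, Finset.card_union_of_disjoint (by simp), h1]
    simp

lemma card_colonVars_zero : (colonVars (.inr (0 : Fin n))).card = n := by
  classical
  simp [colonVars, Finset.card_image_of_injective _ xv_injective]

lemma card_colonVars_inr {k : Fin n} (hk : k ≠ 0) : (colonVars (.inr k)).card = k + 1 := by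
  classical
  have h1 : ((Finset.univ.filter fun l => 0 < l ∧ l < k).image xv).card = k - 1 := by
    rw [Finset.card_image_of_injective _ xv_injective]
    have : (Finset.univ.filter fun l => 0 < l ∧ l < k) = Finset.Ioo 0 k := by ext; simp
    rw [this, Fin.card_Ioo]
    simp
  have h2 : (Finset.univ.image (yv : Fin 2 → CrystalLattice ![n, 2])).card = 2 := by
    rw [Finset.card_image_of_injective _ fun _ _ h => yv_inj.1 h]
    simp
  have h3 : 0 < k.val := Nat.pos_of_ne_zero fun h => hk (Fin.ext h)
  rw [colonVars, if_neg hk, Finset.card_union_of_disjoint, h1, h2]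
  · omega
  · rw [Finset.disjoint_left]
    intro a ha hb
    obtain ⟨i, -, rfl⟩ := Finset.mem_image.1 ha
    obtain ⟨j, -, hj⟩ := Finset.mem_image.1 hb
    exact yv_ne_xv i j hj

lemma sum_card_colonVars_inl :
    ∑ c : Fin 2 × Fin n, (colonVars (.inl c)).card = 2 * n.choose 2 + n := by
  have h : ∑ i : Fin n, (i : ℕ) = n.choose 2 := by
    rw [Fin.sum_univ_eq_sum_range (fun i => i), Finset.sum_range_id, Nat.choose_two_right]
  simp_rw [card_colonVars_inl, Fintype.sum_prod_type, Fin.sum_univ_two, Finset.sum_add_distrib, h]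
  simp
  ring

lemma sum_card_colonVars_inr (hn : 2 ≤ n) :
    ∑ k : Fin n, (colonVars (.inr k)).card = (n - 1).choose 2 + 3 * n - 2 := by
  obtain ⟨m, rfl⟩ : ∃ m, n = m + 1 := ⟨n - 1, by omega⟩
  rw [Fin.sum_univ_succ]
  have h0 : (colonVars (.inr (0 : Fin (m + 1)))).card = m + 1 := by
    convert card_colonVars_zero (n := m + 1)
  have h1 : ∀ i : Fin m, (colonVars (.inr i.succ)).card = i + 2 := fun i => by
    rw [card_colonVars_inr (Fin.succ_ne_zero i)]
    simp
  have h : ∑ i : Fin m, (i : ℕ) = m.choose 2 := by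
    rw [Fin.sum_univ_eq_sum_range (fun i => i), Finset.sum_range_id, Nat.choose_two_right]
  simp_rw [h1, Finset.sum_add_distrib, h]
  rw [h0]
  simp
  omega

variable {K : Type*} [Field K]

theorem betti_one (S : MinimalGradedFreeResolution (crystalInitialIdeal K ![n, 2])) (j : ℤ) :
    S.betti 1 j = if j = 2 then 2 * n else if j = 3 then n else 0 := by
  rw [((linearQuotients n).betti_eq genExp_ne_zero crystalInitialIdeal_eq S j).1,
    Finset.card_filter, Fintype.sum_sum_type]
  simp only [degree_genExp_inl, degree_genExp_inr]
  split_ifs with h2 h3 <;> simp_all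

theorem betti_two (hn : 2 ≤ n) (S : MinimalGradedFreeResolution (crystalInitialIdeal K ![n, 2]))
    (j : ℤ) : S.betti 2 j = if j = 3 then 2 * n.choose 2 + n else
      if j = 4 then (n - 1).choose 2 + 3 * n - 2 else 0 := by
  rw [((linearQuotients n).betti_eq genExp_ne_zero crystalInitialIdeal_eq S j).2,
    Fintype.sum_sum_type]
  simp only [degree_genExp_inl, degree_genExp_inr]
  rw [← sum_card_colonVars_inl, ← sum_card_colonVars_inr hn]
  have h1 : (((2 : ℕ) : ℤ) + 1 = j) ↔ j = 3 := by omega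
  have h2 : (((3 : ℕ) : ℤ) + 1 = j) ↔ j = 4 := by omega
  simp only [h1, h2]
  split_ifs with h3 h4
  · omega
  · simp [linearQuotients]
  · simp [linearQuotients]
  · simp

theorem nonempty_resolution :
    Nonempty (MinimalGradedFreeResolution (crystalInitialIdeal K ![n, 2])) := by
  rw [crystalInitialIdeal_eq]
  exact GradedFree.nonempty_resolution_span_monomial genExp_ne_zero

end Betti

end CrystalLattice

/-! ### The Betti numbers in rows one and two -/

lemma hasSum_nat_of_two_degrees {f : ℤ → ℕ} {a b : ℕ} (hab : a ≠ b)
    (hf : ∀ j : ℤ, j ≠ a → j ≠ b → f j = 0) :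
    HasSum (fun j : ℕ => f j) (f a + f b) := by
  rw [← Finset.sum_pair (f := fun j : ℕ => f j) hab]
  refine hasSum_sum_of_ne_finset_zero fun j hj => hf j ?_ ?_ <;>
    · simp only [Finset.mem_insert, Finset.mem_singleton, not_or] at hj
      omega

theorem theorem1p2 (K : Type*) [Field K] (n₁ : ℕ) (hn₁ : 2 ≤ n₁) :
    Nonempty (MinimalGradedFreeResolution (crystalInitialIdeal K ![n₁, 2])) ∧
    ∀ S : MinimalGradedFreeResolution (crystalInitialIdeal K ![n₁, 2]),
      S.betti 1 2 = 2 * n₁ ∧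
      S.betti 1 3 = n₁ ∧
      S.betti 2 3 = 2 * n₁.choose 2 + n₁ ∧
      S.betti 2 4 = (n₁ - 1).choose 2 + 3 * n₁ - 2 ∧
      HasSum (fun j : ℕ => S.betti 1 j) (S.betti 1 2 + S.betti 1 3) ∧
      S.betti 1 2 + S.betti 1 3 = 3 * n₁ ∧
      HasSum (fun j : ℕ => S.betti 2 j) (S.betti 2 3 + S.betti 2 4) ∧
      ((S.betti 2 3 + S.betti 2 4 : ℕ) : ℚ) = (3 * (n₁ : ℚ) ^ 2 + 3 * n₁ - 2) / 2 := by
  have : NeZero n₁ := ⟨by omega⟩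
  refine ⟨CrystalLattice.nonempty_resolution, fun S => ?_⟩
  have h12 : S.betti 1 2 = 2 * n₁ := by rw [CrystalLattice.betti_one]; simp
  have h13 : S.betti 1 3 = n₁ := by rw [CrystalLattice.betti_one]; simp
  have h23 : S.betti 2 3 = 2 * n₁.choose 2 + n₁ := by
    rw [CrystalLattice.betti_two hn₁]; simp
  have h24 : S.betti 2 4 = (n₁ - 1).choose 2 + 3 * n₁ - 2 := by
    rw [CrystalLattice.betti_two hn₁]; simp
  refine ⟨h12, h13, h23, h24, ?_, by omega, ?_, ?_⟩
  · refine hasSum_nat_of_two_degrees (f := S.betti 1) (a := 2) (b := 3) (by decide) fun j h2 h3 => ?_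
    rw [CrystalLattice.betti_one, if_neg (by exact_mod_cast h2), if_neg (by exact_mod_cast h3)]
  · refine hasSum_nat_of_two_degrees (f := S.betti 2) (a := 3) (b := 4) (by decide) fun j h3 h4 => ?_
    rw [CrystalLattice.betti_two hn₁, if_neg (by exact_mod_cast h3),
      if_neg (by exact_mod_cast h4)]
  · obtain ⟨m, rfl⟩ : ∃ m, n₁ = m + 2 := ⟨n₁ - 2, by omega⟩
    have h : (m + 2 - 1).choose 2 + 3 * (m + 2) - 2 = (m + 1).choose 2 + 3 * m + 4 := by
      have h1 : m + 2 - 1 = m + 1 := rfl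
      rw [h1]
      omega
    rw [h23, h24, h]
    push_cast [Nat.cast_choose_two]
    ring
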